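/- **Theorem ($\operatorname{Prim}(\mathcal D)\cong X$).** Let $\mathcal A$ be a strongly self-absorbing $C^*$-algebra: $\mathcal A$ is nonzero, separable and unital, and there are a $*$-isomorphism $\psi:\mathcal A\to\mathcal A\otimes\mathcal A$ (minimal tensor product) and unitaries $v_n\in\mathcal A\otimes\mathcal A$ such that $\|v_n\psi(a)v_n^*-a\otimes 1\|\to 0$ for every $a\in\mathcal A$ (the case $\mathcal A=\mathbb C$ is included). Let $\mathcal K$ be the $C^*$-algebra of compact operators on the separable infinite-dimensional Hilbert space. Let $X$ be a Hausdorff finite-dimensional topological manifold that is the total space of a principal circle bundle $p:X\to W$. Let $\mathcal D$ be the section algebra of a locally trivial $C^*$-bundle over $X$ with fiber $\mathcal A\otimes\mathcal K$, that is, the $C^*$-algebra, in the supremum norm, of the continuous sections $s$ of the bundle for which $x\mapsto\|s(x)\|$ vanishes at infinity. For $t\in X$ let $I_t\subset\mathcal D$ be the ideal of all sections that vanish at $t$. Then each $I_t$ is a primitive ideal of $\mathcal D$, and $t\mapsto I_t$ is a homeomorphism of $X$ onto the primitive ideal space $\operatorname{Prim}(\mathcal D)$, the set of kernels of irreducible representations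 of $\mathcal D$ with the hull-kernel topology. -/

import Mathlib

open scoped TensorProduct ENNReal
open Topology Filter

noncomputable section

universe u v

section PrimitiveIdealSpace

/-- An irreducible representation of a `*`-algebra on a Hilbert space: a nonzero representation
that leaves no closed subspace invariant except `0` and the whole space. -/
def IsIrreducibleRep {D : Type*} [NonUnitalCStarAlgebra D] {H : Type*} [NormedAddCommGroup H]
    [InnerProductSpace ℂ H] [CompleteSpace H] (π : D →⋆ₙₐ[ℂ] (H →L[ℂ] H)) : Prop :=
  π ≠ 0 ∧ ∀ V : Submodule ℂ H, IsClosed (V : Set H) →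
    (∀ d : D, ∀ ξ ∈ V, π d ξ ∈ V) → V = ⊥ ∨ V = ⊤

/-- A primitive ideal of a C*-algebra: the kernel of an irreducible representation. (A Hilbert
space carrying an irreducible representation of `D` is a completion of a quotient of `D`, so
Hilbert spaces in the universe of `D` suffice.) -/
def IsPrimitiveIdeal {D : Type u} [NonUnitalCStarAlgebra D] (I : TwoSidedIdeal D) : Prop :=
  ∃ (H : Type u) (_ : NormedAddCommGroup H) (_ : InnerProductSpace ℂ H) (_ : CompleteSpace H)
    (π : D →⋆ₙₐ[ℂ] (H →L[ℂ] H)), IsIrreducibleRep π ∧ I = TwoSidedIdeal.ker π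

/-- `Prim D`, the set of primitive ideals of `D`. -/
def Prim (D : Type u) [NonUnitalCStarAlgebra D] : Type u :=
  {I : TwoSidedIdeal D // IsPrimitiveIdeal I}

/-- The hull of an ideal `J`: the primitive ideals that contain `J`. -/
def hull {D : Type u} [NonUnitalCStarAlgebra D] (J : TwoSidedIdeal D) : Set (Prim D) :=
  {P | J ≤ P.1}

/-- Primitive ideals are prime. -/
theorem IsPrimitiveIdeal.le_or_le {D : Type u} [NonUnitalCStarAlgebra D] {P : TwoSidedIdeal D}
    (hP : IsPrimitiveIdeal P) {I J : TwoSidedIdeal D} (h : I ⊓ J ≤ P) : I ≤ P ∨ J ≤ P := by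
  obtain ⟨H, _, _, _, π, ⟨-, hirr⟩, rfl⟩ := hP
  let V : Submodule ℂ H := Submodule.span ℂ {η | ∃ j ∈ J, ∃ ξ, η = π j ξ}
  have hV : ∀ d : D, ∀ ξ ∈ V, π d ξ ∈ V := by
    intro d ξ hξ
    induction hξ using Submodule.span_induction with
    | mem x hx =>
      obtain ⟨j, hj, ξ, rfl⟩ := hx
      exact Submodule.subset_span ⟨d * j, J.mul_mem_left _ _ hj, ξ, by simp⟩
    | zero => simp
    | add x y _ _ hx hy => rw [map_add]; exact V.add_mem hx hy
    | smul c x _ hx => rw [map_smul]; exact V.smul_mem c hx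
  have hVc : ∀ d : D, ∀ ξ ∈ V.topologicalClosure, π d ξ ∈ V.topologicalClosure := by
    intro d ξ hξ
    exact map_mem_closure (π d).continuous hξ (hV d)
  rcases hirr V.topologicalClosure V.isClosed_topologicalClosure hVc with h0 | h1
  · right
    intro j hj
    rw [TwoSidedIdeal.mem_ker]
    ext ξ
    have : π j ξ ∈ V.topologicalClosure :=
      V.le_topologicalClosure (Submodule.subset_span ⟨j, hj, ξ, rfl⟩)
    rw [h0] at this
    simpa using this
  · left
    intro i hi
    rw [TwoSidedIdeal.mem_ker]
    have hz : ∀ η ∈ V, π i η = 0 := by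
      intro η hη
      induction hη using Submodule.span_induction with
      | mem x hx =>
        obtain ⟨j, hj, ξ, rfl⟩ := hx
        have : i * j ∈ TwoSidedIdeal.ker π :=
          h ⟨I.mul_mem_right _ _ hi, J.mul_mem_left _ _ hj⟩
        rw [TwoSidedIdeal.mem_ker, map_mul] at this
        simpa using DFunLike.congr_fun this ξ
      | zero => simp
      | add x y _ _ hx hy => rw [map_add, hx, hy, add_zero]
      | smul c x _ hx => rw [map_smul, hx, smul_zero]
    ext η
    have hη : η ∈ V.topologicalClosure := by rw [h1]; trivial
    have hcl : IsClosed {η | π i η = 0} := isClosed_eq (π i).continuous continuous_const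
    exact (closure_minimal (s := (V : Set H)) hz hcl) hη

/-- The Jacobson (hull-kernel) topology on `Prim D`: the closed sets are the hulls of ideals. -/
instance {D : Type u} [NonUnitalCStarAlgebra D] : TopologicalSpace (Prim D) :=
  TopologicalSpace.ofClosed (Set.range hull)
    ⟨⊤, by
      ext P
      simp only [hull, Set.mem_ofPred_eq, Set.mem_empty_iff_false, iff_false]
      intro hP
      obtain ⟨H, _, _, _, π, ⟨h0, -⟩, hI⟩ := P.2
      refine h0 (NonUnitalStarAlgHom.ext fun d => ?_)
      have : d ∈ P.1 := hP trivial
      rw [hI, TwoSidedIdeal.mem_ker] at this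
      simpa using this⟩
    (by
      intro A hA
      refine ⟨sSup {J | hull J ∈ A}, ?_⟩
      ext P
      simp only [hull, Set.mem_ofPred_eq, sSup_le_iff, Set.mem_sInter]
      constructor
      · intro h S hS
        obtain ⟨J, rfl⟩ := hA hS
        exact h J hS
      · intro h J hJ
        exact h _ hJ)
    (by
      rintro _ ⟨I, rfl⟩ _ ⟨J, rfl⟩
      refine ⟨I ⊓ J, ?_⟩
      ext P
      simp only [hull, Set.mem_ofPred_eq, Set.mem_union]
      exact ⟨fun h => P.2.le_or_le h, fun h => h.elim (inf_le_left.trans ·) (inf_le_right.trans ·)⟩)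

end PrimitiveIdealSpace

section SpatialTensorProduct

section HilbertTensor

variable (H K : Type*) [NormedAddCommGroup H] [InnerProductSpace ℂ H]
    [NormedAddCommGroup K] [InnerProductSpace ℂ K]

/-- The Hilbert space tensor product: the completion of the algebraic tensor product. -/
def HilbertTensor : Type _ := UniformSpace.Completion (H ⊗[ℂ] K)

instance : NormedAddCommGroup (HilbertTensor H K) :=
  inferInstanceAs (NormedAddCommGroup (UniformSpace.Completion (H ⊗[ℂ] K)))

instance : InnerProductSpace ℂ (HilbertTensor H K) :=
  inferInstanceAs (InnerProductSpace ℂ (UniformSpace.Completion (H ⊗[ℂ] K)))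

instance : CompleteSpace (HilbertTensor H K) :=
  inferInstanceAs (CompleteSpace (UniformSpace.Completion (H ⊗[ℂ] K)))

variable {H K}

/-- The elementary tensor `ξ ⊗ η` in the Hilbert space tensor product. -/
def HilbertTensor.tmul (ξ : H) (η : K) : HilbertTensor H K :=
  ((ξ ⊗ₜ[ℂ] η : H ⊗[ℂ] K) : UniformSpace.Completion (H ⊗[ℂ] K))

theorem HilbertTensor.inner_tmul (ξ ξ' : H) (η η' : K) :
    inner ℂ (tmul ξ η) (tmul ξ' η') = inner ℂ ξ ξ' * inner ℂ η η' :=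
  (UniformSpace.Completion.inner_coe _ _).trans (TensorProduct.inner_tmul ℂ ξ ξ' η η')

/-- The bounded operator `S ⊗ T` on the Hilbert space tensor product, determined by
`(S ⊗ T) (ξ ⊗ η) = S ξ ⊗ T η`. -/
def tensorOp (S : H →L[ℂ] H) (T : K →L[ℂ] K) : HilbertTensor H K →L[ℂ] HilbertTensor H K :=
  (TensorProduct.mapL S T).completion

theorem tensorOp_tmul (S : H →L[ℂ] H) (T : K →L[ℂ] K) (ξ : H) (η : K) :
    tensorOp S T (HilbertTensor.tmul ξ η) = HilbertTensor.tmul (S ξ) (T η) :=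
  ContinuousLinearMap.completion_apply_coe (TensorProduct.mapL S T) (ξ ⊗ₜ[ℂ] η)

end HilbertTensor

/-- The spatial tensor product of the C*-algebras `A` and `B`, formed with representations `π` and
`ρ`: the C*-algebra of operators on the Hilbert space tensor product that is generated by the
operators `π a ⊗ ρ b`. If `π` and `ρ` are faithful, this is the minimal C*-tensor product of `A`
and `B`, which does not depend on the choice of the faithful representations. -/
def spatialTensor {A B H K : Type*} [NonUnitalCStarAlgebra A] [NonUnitalCStarAlgebra B]
    [NormedAddCommGroup H] [InnerProductSpace ℂ H] [CompleteSpace H]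
    [NormedAddCommGroup K] [InnerProductSpace ℂ K] [CompleteSpace K]
    (π : A →⋆ₙₐ[ℂ] (H →L[ℂ] H)) (ρ : B →⋆ₙₐ[ℂ] (K →L[ℂ] K)) :
    NonUnitalStarSubalgebra ℂ (HilbertTensor H K →L[ℂ] HilbertTensor H K) :=
  (NonUnitalStarAlgebra.adjoin ℂ
    (Set.range fun p : A × B => tensorOp (π p.1) (ρ p.2))).topologicalClosure

/-- A strongly self-absorbing C*-algebra: `A` is unital, separable and nonzero, and there is a
`*`-isomorphism `ψ : A → A ⊗ A` that is approximately unitarily equivalent to `a ↦ a ⊗ 1`. Here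
`A ⊗ A` is the minimal tensor product, formed with a faithful unital representation `π` of `A`. -/
def IsStronglySelfAbsorbing (A : Type u) [CStarAlgebra A] : Prop :=
  Nontrivial A ∧ TopologicalSpace.SeparableSpace A ∧
  ∃ (H : Type u) (_ : NormedAddCommGroup H) (_ : InnerProductSpace ℂ H) (_ : CompleteSpace H)
    (π : A →⋆ₐ[ℂ] (H →L[ℂ] H)), Function.Injective π ∧
    ∃ (ψ : A ≃⋆ₐ[ℂ] spatialTensor π.toNonUnitalStarAlgHom π.toNonUnitalStarAlgHom)
      (w : ℕ → (HilbertTensor H H →L[ℂ] HilbertTensor H H)),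
      (∀ n, w n ∈ unitary (HilbertTensor H H →L[ℂ] HilbertTensor H H) ∧
        w n ∈ spatialTensor π.toNonUnitalStarAlgHom π.toNonUnitalStarAlgHom) ∧
      ∀ a : A, Tendsto (fun n => ‖w n * (ψ a : HilbertTensor H H →L[ℂ] HilbertTensor H H) *
        star (w n) - tensorOp (π a) 1‖) atTop (𝓝 0)

/-- The adjoint of a compact operator on a Hilbert space is compact. -/
theorem IsCompactOperator.star_clm {H : Type*} [NormedAddCommGroup H] [InnerProductSpace ℂ H]
    [CompleteSpace H] {T : H →L[ℂ] H} (hT : IsCompactOperator T) :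
    IsCompactOperator (star T : H →L[ℂ] H) := by
  have hS : IsCompactOperator (T * star T : H →L[ℂ] H) := hT.comp_clm (star T)
  have htb : TotallyBounded ((T * star T : H →L[ℂ] H) '' Metric.ball 0 1) :=
    (hS.isCompact_closure_image_ball (f := (T * star T : H →L[ℂ] H).toLinearMap) 1).totallyBounded.subset
      subset_closure
  refine (isCompactOperator_iff_isCompact_closure_image_ball
    (f := (star T : H →L[ℂ] H).toLinearMap) one_pos).2 ?_
  refine (TotallyBounded.isCompact_of_isClosed ?_ isClosed_closure)
  refine TotallyBounded.closure ?_
  rw [Metric.totallyBounded_iff]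
  intro ε hε
  obtain ⟨t, hts, htf, ht⟩ := htb.exists_subset (Metric.dist_mem_uniformity
    (show (0 : ℝ) < ε ^ 2 / 2 by positivity))
  choose! g hg hgt using fun y (hy : y ∈ t) => hts hy
  refine ⟨(fun y => (star T : H →L[ℂ] H) (g y)) '' t, htf.image _, ?_⟩
  rintro _ ⟨x, hx, rfl⟩
  obtain ⟨y, hy, hxy⟩ := Set.mem_iUnion₂.1 (ht ⟨x, hx, rfl⟩)
  refine Set.mem_iUnion₂.2 ⟨_, ⟨y, hy, rfl⟩, ?_⟩
  have hxy' : ‖(T * star T : H →L[ℂ] H) (x - g y)‖ < ε ^ 2 / 2 := by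
    rw [map_sub, hgt y hy, ← dist_eq_norm]
    exact hxy
  have h2 : ‖x - g y‖ ≤ 2 := by
    have h3 := mem_ball_zero_iff.1 hx
    have h4 := mem_ball_zero_iff.1 (hg y hy)
    linarith [norm_sub_le x (g y)]
  have key : ‖(star T : H →L[ℂ] H) (x - g y)‖ ^ 2 < ε ^ 2 := by
    calc ‖(star T : H →L[ℂ] H) (x - g y)‖ ^ 2
        = RCLike.re (inner ℂ ((T * star T : H →L[ℂ] H) (x - g y)) (x - g y)) := by
          rw [ContinuousLinearMap.star_eq_adjoint, mul_apply_eq_comp,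
            ← ContinuousLinearMap.adjoint_inner_right, ← norm_sq_eq_re_inner]
      _ ≤ ‖(T * star T : H →L[ℂ] H) (x - g y)‖ * ‖x - g y‖ := re_inner_le_norm _ _
      _ ≤ ‖(T * star T : H →L[ℂ] H) (x - g y)‖ * 2 := by gcongr
      _ < ε ^ 2 := by linarith
  rw [Metric.mem_ball, dist_eq_norm]
  have := lt_of_pow_lt_pow_left₀ 2 hε.le key
  simpa using this

/-- `ℓ²(ℕ)`, the separable infinite-dimensional Hilbert space. -/
abbrev EllTwo : Type := lp (fun _ : ℕ => ℂ) 2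

/-- The C*-algebra `𝒦` of compact operators on `ℓ²(ℕ)`. -/
def compactOps : NonUnitalStarSubalgebra ℂ (EllTwo →L[ℂ] EllTwo) where
  carrier := {T | IsCompactOperator T}
  add_mem' h h' := h.add h'
  zero_mem' := isCompactOperator_zero
  mul_mem' {_ T} h _ := h.comp_clm T
  smul_mem' c _ h := h.smul c
  star_mem' h := h.star_clm

instance compactOps_isClosed : IsClosed (compactOps : Set (EllTwo →L[ℂ] EllTwo)) :=
  isClosed_setOfPred_isCompactOperator

/-- `F` is (isomorphic to) the stabilization `A ⊗ 𝒦`: the spatial tensor product formed with a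
faithful representation of `A` and with the identity representation of `𝒦` on `ℓ²(ℕ)`. -/
def IsStabilization (A : Type u) [CStarAlgebra A] (F : Type*) [NonUnitalCStarAlgebra F] : Prop :=
  ∃ (H : Type u) (_ : NormedAddCommGroup H) (_ : InnerProductSpace ℂ H) (_ : CompleteSpace H)
    (π : A →⋆ₙₐ[ℂ] (H →L[ℂ] H)), Function.Injective π ∧
    Nonempty (F ≃⋆ₐ[ℂ] spatialTensor π (NonUnitalStarSubalgebraClass.subtype compactOps))

end SpatialTensorProduct

section CStarBundle

variable {X : Type*} [TopologicalSpace X] (F : Type*) [NonUnitalCStarAlgebra F]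
  (E : X → Type*) [∀ x, NonUnitalCStarAlgebra (E x)] [TopologicalSpace (Bundle.TotalSpace F E)]
  [FiberBundle F E]

/-- A locally trivial C*-bundle over `X` with fiber the C*-algebra `F`: a locally trivial fiber
bundle of C*-algebras whose local trivializations are fiberwise `*`-isomorphisms onto `F`. -/
class IsCStarBundle : Prop where
  exists_starAlgEquiv : ∀ e ∈ FiberBundle.trivializationAtlas F E, ∀ x ∈ e.baseSet,
    ∃ φ : E x ≃⋆ₐ[ℂ] F, ∀ a : E x, (e (Bundle.TotalSpace.mk' F x a)).2 = φ a

/-- Continuity at `x₀` of a section, in the local trivialization at `x₀`. -/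
def SectionContinuousAt (s : ∀ x, E x) (x₀ : X) : Prop :=
  ContinuousAt (fun x => (trivializationAt F E x₀ (Bundle.TotalSpace.mk' F x (s x))).2) x₀

theorem continuous_section_iff (s : ∀ x, E x) :
    Continuous (fun x => Bundle.TotalSpace.mk' F x (s x)) ↔ ∀ x₀, SectionContinuousAt F E s x₀ := by
  rw [continuous_iff_continuousAt]
  refine forall_congr' fun x₀ => ?_
  rw [FiberBundle.continuousAt_totalSpace]
  exact and_iff_right continuousAt_id

variable [IsCStarBundle F E]

theorem eventually_starAlgEquiv (x₀ : X) : ∀ᶠ x in 𝓝 x₀, ∃ φ : E x ≃⋆ₐ[ℂ] F, ∀ a : E x,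
    (trivializationAt F E x₀ (Bundle.TotalSpace.mk' F x a)).2 = φ a := by
  have h := (trivializationAt F E x₀).open_baseSet.mem_nhds
    (FiberBundle.mem_baseSet_trivializationAt F E x₀)
  filter_upwards [h] with x hx
  exact IsCStarBundle.exists_starAlgEquiv _ (FiberBundle.trivialization_mem_atlas F E x₀) x hx

/-- The section algebra of a C*-bundle: the C*-algebra, in the supremum norm, of the continuous
sections `s` for which `x ↦ ‖s x‖` vanishes at infinity. Such sections are bounded, and the
algebra is realized inside the C*-algebra `lp E ∞` of all bounded sections. -/
def sectionAlgebra : NonUnitalStarSubalgebra ℂ (lp E ∞) where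
  carrier := {s | Continuous (fun x => Bundle.TotalSpace.mk' F x (s x)) ∧
    Tendsto (fun x => ‖s x‖) (cocompact X) (𝓝 0)}
  add_mem' := by
    rintro s t ⟨hs, hs'⟩ ⟨ht, ht'⟩
    rw [continuous_section_iff] at hs ht
    refine ⟨(continuous_section_iff F E _).2 fun x₀ => ?_, ?_⟩
    · refine (ContinuousAt.add (hs x₀) (ht x₀)).congr ?_
      filter_upwards [eventually_starAlgEquiv F E x₀] with x ⟨φ, hφ⟩
      simp [hφ]
    · refine squeeze_zero (fun _ => norm_nonneg _) (fun x => norm_add_le _ _) ?_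
      simpa using hs'.add ht'
  zero_mem' := by
    refine ⟨(continuous_section_iff F E _).2 fun x₀ => ?_, by simpa using tendsto_const_nhds⟩
    refine (continuousAt_const (y := (0 : F))).congr ?_
    filter_upwards [eventually_starAlgEquiv F E x₀] with x ⟨φ, hφ⟩
    simp [hφ]
  mul_mem' := by
    rintro s t ⟨hs, hs'⟩ ⟨ht, ht'⟩
    rw [continuous_section_iff] at hs ht
    refine ⟨(continuous_section_iff F E _).2 fun x₀ => ?_, ?_⟩
    · refine (ContinuousAt.mul (hs x₀) (ht x₀)).congr ?_
      filter_upwards [eventually_starAlgEquiv F E x₀] with x ⟨φ, hφ⟩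
      simp [hφ]
    · refine squeeze_zero (fun _ => norm_nonneg _) (fun x => norm_mul_le _ _) ?_
      simpa using hs'.mul ht'
  smul_mem' := by
    rintro c s ⟨hs, hs'⟩
    rw [continuous_section_iff] at hs
    refine ⟨(continuous_section_iff F E _).2 fun x₀ => ?_, ?_⟩
    · refine (ContinuousAt.const_smul (hs x₀) c).congr ?_
      filter_upwards [eventually_starAlgEquiv F E x₀] with x ⟨φ, hφ⟩
      simp [hφ]
    · simpa [norm_smul] using hs'.const_mul ‖c‖
  star_mem' := by
    rintro s ⟨hs, hs'⟩
    rw [continuous_section_iff] at hs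
    refine ⟨(continuous_section_iff F E _).2 fun x₀ => ?_, ?_⟩
    · refine (ContinuousAt.star (hs x₀)).congr ?_
      filter_upwards [eventually_starAlgEquiv F E x₀] with x ⟨φ, hφ⟩
      simp [hφ, map_star]
    · simpa using hs'

instance sectionAlgebra_isClosed : IsClosed (sectionAlgebra F E : Set (lp E ∞)) := by
  refine isClosed_of_closure_subset fun s hs => ?_
  rw [Metric.mem_closure_iff] at hs
  have hle : ∀ (t : lp E ∞) (x : X), ‖s x - t x‖ ≤ dist s t := fun t x => by
    rw [dist_eq_norm]; exact lp.norm_apply_le_norm (by simp) (s - t) x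
  refine ⟨(continuous_section_iff F E _).2 fun x₀ => ?_, ?_⟩
  · refine continuousAt_of_locally_uniform_approx_of_continuousAt fun u hu => ?_
    obtain ⟨ε, hε, hεu⟩ := Metric.mem_uniformity_dist.1 hu
    obtain ⟨t, ht, hst⟩ := hs ε hε
    refine ⟨_, eventually_starAlgEquiv F E x₀, _, (continuous_section_iff F E _).1 ht.1 x₀, ?_⟩
    rintro x ⟨φ, hφ⟩
    apply hεu
    rw [hφ, hφ, dist_eq_norm, ← map_sub,
      NonUnitalStarAlgHom.norm_map φ (EquivLike.injective φ)]
    exact (hle t x).trans_lt hst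
  · rw [Metric.tendsto_nhds]
    intro ε hε
    obtain ⟨t, ht, hst⟩ := hs (ε / 2) (half_pos hε)
    filter_upwards [Metric.tendsto_nhds.1 ht.2 (ε / 2) (half_pos hε)] with x hx
    simp only [dist_zero_right, norm_norm] at hx ⊢
    have := norm_add_le (s x - t x) (t x)
    rw [sub_add_cancel] at this
    linarith [hle t x]

/-- `I_t`: the ideal of the sections that vanish at `t`. -/
def vanishingIdeal (t : X) : TwoSidedIdeal (sectionAlgebra F E) :=
  TwoSidedIdeal.mk' {s | (s : lp E ∞) t = 0} (by simp)
    (fun {s s'} hs hs' => by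
      simp only [Set.mem_ofPred_eq] at hs hs' ⊢
      simp [hs, hs'])
    (fun {s} hs => by
      simp only [Set.mem_ofPred_eq] at hs ⊢
      simp [hs])
    (fun {s s'} hs => by
      simp only [Set.mem_ofPred_eq] at hs ⊢
      simp [hs])
    (fun {s s'} hs => by
      simp only [Set.mem_ofPred_eq] at hs ⊢
      simp [hs])

theorem mem_vanishingIdeal {t : X} {s : sectionAlgebra F E} :
    s ∈ vanishingIdeal F E t ↔ (s : lp E ∞) t = 0 :=
  TwoSidedIdeal.mem_mk' ..

end CStarBundle

/-- `p : X → W` is a principal circle bundle for the given action of the circle group on `X`: the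
base is covered by open sets over which there are equivariant local trivializations, the circle
acting on itself by translation. (The action on `X` is then automatically continuous and free, and
`p` is an open surjection.) -/
structure IsPrincipalCircleBundle {X W : Type*} [TopologicalSpace X] [TopologicalSpace W]
    [MulAction Circle X] (p : X → W) : Prop where
  continuous : Continuous p
  proj_smul : ∀ (z : Circle) (x : X), p (z • x) = p x
  exists_trivialization : ∀ w : W, ∃ e : Bundle.Trivialization Circle p, w ∈ e.baseSet ∧
    ∀ x, p x ∈ e.baseSet → ∀ z : Circle, (e (z • x)).2 = z * (e x).2

end

/-! The quotient of the section algebra by `I_t` is the fiber over `t`, a copy of `A ⊗ 𝒦`, which is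
simple. So a primitive ideal above `I_t` equals `I_t` (`IsPrimitiveIdeal.eq_vanishingIdeal`). Three
points remain.

Every primitive ideal `P` lies above some `I_t` (`IsPrimitiveIdeal.exists_vanishingIdeal_le`): `P`
is closed and prime, and sections are small off a compact set, so if every `I_t` failed to lie in
`P`, a finite cover would place a section outside `P` that vanishes everywhere. Each `I_t` is
primitive: by GNS and Krein-Milman some primitive ideal lies above it, hence equals it. The
topologies agree because norms of sections are continuous and bump sections separate points from
closed sets.

Simplicity of `A` (`IsStronglySelfAbsorbing.one_mem`): let `I` be a proper closed ideal and `i ∈ I`.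
Then `1 ⊗ i = ψ j` for some `j`, and unitary conjugates of `ψ j`, all in the closed ideal `A ⊗ I`,
converge to `j ⊗ 1`. The left slices of `j ⊗ 1` are scalars in `I`, so they vanish, and `j = 0 = i`.
Stabilizing keeps simplicity, by compression to a rank one corner. -/

noncomputable section

open scoped CStarAlgebra

/-! ### Tensor products of operators, and slice maps. -/

section SpatialTensorProduct

variable {H K : Type*} [NormedAddCommGroup H] [InnerProductSpace ℂ H]
    [NormedAddCommGroup K] [InnerProductSpace ℂ K]

variable (H K) in
/-- The elementary tensors as a bounded bilinear map into the Hilbert space tensor product. -/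
def HilbertTensor.tmulL : H →L[ℂ] K →L[ℂ] HilbertTensor H K :=
  (ContinuousLinearMap.compL ℂ K (H ⊗[ℂ] K) (HilbertTensor H K)
    (UniformSpace.Completion.toComplL (𝕜 := ℂ) (E := H ⊗[ℂ] K))).comp (TensorProduct.mkL ℂ H K)

theorem HilbertTensor.tmulL_apply (ξ : H) (η : K) : tmulL H K ξ η = tmul ξ η := rfl

/-- Elementary tensors span the algebraic tensor product, which is dense in its completion. -/
theorem HilbertTensor.clm_ext {G : Type*} [NormedAddCommGroup G] [NormedSpace ℂ G]
    {S T : HilbertTensor H K →L[ℂ] G} (h : ∀ ξ η, S (tmul ξ η) = T (tmul ξ η)) : S = T := by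
  refine ContinuousLinearMap.ext fun x => ?_
  refine UniformSpace.Completion.induction_on (p := fun x => S x = T x) x
    (isClosed_eq S.continuous T.continuous) fun x => ?_
  induction x using TensorProduct.induction_on with
  | zero => exact (map_zero S).trans (map_zero T).symm
  | tmul ξ η => exact h ξ η
  | add x y hx hy =>
    exact (congrArg S (UniformSpace.Completion.coe_add x y)).trans <| (map_add S _ _).trans <|
      (congrArg₂ (· + ·) hx hy).trans <| (map_add T _ _).symm.trans
      (congrArg T (UniformSpace.Completion.coe_add x y)).symm

theorem norm_tensorOp_le (S : H →L[ℂ] H) (T : K →L[ℂ] K) : ‖tensorOp S T‖ ≤ ‖S‖ * ‖T‖ := by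
  refine ContinuousLinearMap.opNorm_le_bound _ (by positivity) fun x => ?_
  refine UniformSpace.Completion.induction_on
    (p := fun x => ‖tensorOp S T x‖ ≤ ‖S‖ * ‖T‖ * ‖x‖) x
    (isClosed_le (tensorOp S T).continuous.norm (continuous_const.mul continuous_norm)) fun x => ?_
  have h : tensorOp S T ((x : UniformSpace.Completion (H ⊗[ℂ] K)) : HilbertTensor H K) =
      ((TensorProduct.mapL S T x : H ⊗[ℂ] K) : UniformSpace.Completion (H ⊗[ℂ] K)) :=
    ContinuousLinearMap.completion_apply_coe (TensorProduct.mapL S T) x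
  rw [h]
  refine (UniformSpace.Completion.norm_coe _).trans_le ?_
  refine ((TensorProduct.mapL S T).le_opNorm x).trans ?_
  rw [UniformSpace.Completion.norm_coe]
  gcongr
  exact TensorProduct.norm_mapL_le S T

/-- The map `(S, T) ↦ S ⊗ T` as a bounded bilinear map. -/
def tensorOpL : (H →L[ℂ] H) →L[ℂ] (K →L[ℂ] K) →L[ℂ] (HilbertTensor H K →L[ℂ] HilbertTensor H K) :=
  LinearMap.mkContinuous₂ (LinearMap.mk₂ ℂ tensorOp
    (fun S S' T => HilbertTensor.clm_ext fun ξ η => by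
      simp [tensorOp_tmul]; simp [← HilbertTensor.tmulL_apply])
    (fun c S T => HilbertTensor.clm_ext fun ξ η => by
      simp [tensorOp_tmul]; simp [← HilbertTensor.tmulL_apply])
    (fun S T T' => HilbertTensor.clm_ext fun ξ η => by
      simp [tensorOp_tmul]; simp [← HilbertTensor.tmulL_apply])
    (fun c S T => HilbertTensor.clm_ext fun ξ η => by
      simp [tensorOp_tmul]; simp [← HilbertTensor.tmulL_apply])) 1
    (fun S T => by simpa using norm_tensorOp_le S T)

theorem tensorOpL_apply (S : H →L[ℂ] H) (T : K →L[ℂ] K) : tensorOpL S T = tensorOp S T := rfl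

theorem tensorOp_mul (S S' : H →L[ℂ] H) (T T' : K →L[ℂ] K) :
    tensorOp S T * tensorOp S' T' = tensorOp (S * S') (T * T') :=
  HilbertTensor.clm_ext fun ξ η => by simp [tensorOp_tmul]

variable [CompleteSpace H] [CompleteSpace K]

theorem star_tensorOp (S : H →L[ℂ] H) (T : K →L[ℂ] K) :
    star (tensorOp S T) = tensorOp (star S) (star T) := by
  refine HilbertTensor.clm_ext fun ξ η => ?_
  refine ext_inner_right ℂ fun x => ?_
  rw [ContinuousLinearMap.star_eq_adjoint, ContinuousLinearMap.adjoint_inner_left]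
  -- Read as functionals of `x`, the two sides need comparing only on elementary tensors.
  have : (innerSL ℂ (HilbertTensor.tmul ξ η)).comp (tensorOp S T) =
      innerSL ℂ (tensorOp (star S) (star T) (HilbertTensor.tmul ξ η)) := by
    refine HilbertTensor.clm_ext fun ξ' η' => ?_
    simp [tensorOp_tmul, HilbertTensor.inner_tmul, ContinuousLinearMap.star_eq_adjoint,
      ContinuousLinearMap.adjoint_inner_left]
  exact DFunLike.congr_fun this x

/-- The slice map `S ⊗ T ↦ ⟪ξ, S ξ'⟫ T`. -/
def leftSlice (ξ ξ' : H) : (HilbertTensor H K →L[ℂ] HilbertTensor H K) →L[ℂ] (K →L[ℂ] K) :=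
  -- This is `T ↦ V* T V'` with `V η = ξ ⊗ η` and `V' η = ξ' ⊗ η`.
  (ContinuousLinearMap.compL ℂ K (HilbertTensor H K) K
    (ContinuousLinearMap.adjoint (HilbertTensor.tmulL H K ξ))).comp
  ((ContinuousLinearMap.compL ℂ K (HilbertTensor H K) (HilbertTensor H K)).flip
    (HilbertTensor.tmulL H K ξ'))

theorem inner_leftSlice (ξ ξ' : H) (T : HilbertTensor H K →L[ℂ] HilbertTensor H K) (η η' : K) :
    inner ℂ η (leftSlice ξ ξ' T η') =
      inner ℂ (HilbertTensor.tmul ξ η) (T (HilbertTensor.tmul ξ' η')) := by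
  simp [leftSlice, ContinuousLinearMap.adjoint_inner_right, HilbertTensor.tmulL_apply]

theorem leftSlice_tensorOp (ξ ξ' : H) (S : H →L[ℂ] H) (T : K →L[ℂ] K) :
    leftSlice ξ ξ' (tensorOp S T) = inner ℂ ξ (S ξ') • T := by
  refine ContinuousLinearMap.ext fun η' => ext_inner_left ℂ fun η => ?_
  rw [inner_leftSlice, tensorOp_tmul, HilbertTensor.inner_tmul]
  simp [inner_smul_right]

/-- The slice map `S ⊗ T ↦ ⟪η, T η'⟫ S`. -/
def rightSlice (η η' : K) : (HilbertTensor H K →L[ℂ] HilbertTensor H K) →L[ℂ] (H →L[ℂ] H) :=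
  (ContinuousLinearMap.compL ℂ H (HilbertTensor H K) H
    (ContinuousLinearMap.adjoint ((HilbertTensor.tmulL H K).flip η))).comp
  ((ContinuousLinearMap.compL ℂ H (HilbertTensor H K) (HilbertTensor H K)).flip
    ((HilbertTensor.tmulL H K).flip η'))

theorem inner_rightSlice (η η' : K) (T : HilbertTensor H K →L[ℂ] HilbertTensor H K) (ξ ξ' : H) :
    inner ℂ ξ (rightSlice η η' T ξ') =
      inner ℂ (HilbertTensor.tmul ξ η) (T (HilbertTensor.tmul ξ' η')) := by
  simp [rightSlice, ContinuousLinearMap.adjoint_inner_right, HilbertTensor.tmulL_apply]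

theorem rightSlice_tensorOp (η η' : K) (S : H →L[ℂ] H) (T : K →L[ℂ] K) :
    rightSlice η η' (tensorOp S T) = inner ℂ η (T η') • S := by
  refine ContinuousLinearMap.ext fun ξ' => ext_inner_left ℂ fun ξ => ?_
  rw [inner_rightSlice, tensorOp_tmul, HilbertTensor.inner_tmul]
  simp [inner_smul_right, mul_comm]

/-- An operator is determined by its right slices. -/
theorem eq_zero_of_rightSlice_eq_zero {T : HilbertTensor H K →L[ℂ] HilbertTensor H K}
    (h : ∀ η η', rightSlice η η' T = 0) : T = 0 := by
  refine HilbertTensor.clm_ext fun ξ' η' => ?_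
  have : innerSL ℂ (T (HilbertTensor.tmul ξ' η')) = 0 := by
    refine HilbertTensor.clm_ext fun ξ η => ?_
    have h1 := inner_rightSlice η η' T ξ ξ'
    rw [h] at h1
    simpa using (congrArg (starRingEnd ℂ) h1).symm
  have := DFunLike.congr_fun this (T (HilbertTensor.tmul ξ' η'))
  simpa using this

section Spatial

variable {A B : Type*} [NonUnitalCStarAlgebra A] [NonUnitalCStarAlgebra B]
  (π : A →⋆ₙₐ[ℂ] (H →L[ℂ] H)) (ρ : B →⋆ₙₐ[ℂ] (K →L[ℂ] K))

theorem tensorOp_mem_spatialTensor (a : A) (b : B) : tensorOp (π a) (ρ b) ∈ spatialTensor π ρ :=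
  NonUnitalStarSubalgebra.le_topologicalClosure _
    (NonUnitalStarAlgebra.subset_adjoin ℂ _ ⟨(a, b), rfl⟩)

variable {π ρ} in
/-- The spatial tensor product is the closed linear span of the elementary tensors. -/
theorem spatialTensor_induction
    {M : Submodule ℂ (HilbertTensor H K →L[ℂ] HilbertTensor H K)} (hM : IsClosed (M : Set
      (HilbertTensor H K →L[ℂ] HilbertTensor H K))) (h : ∀ a b, tensorOp (π a) (ρ b) ∈ M)
    {T : HilbertTensor H K →L[ℂ] HilbertTensor H K} (hT : T ∈ spatialTensor π ρ) : T ∈ M := by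
  set s := Set.range fun p : A × B => tensorOp (π p.1) (ρ p.2)
  -- Elementary tensors are stable under products and adjoints, so the `*`-algebra they generate is
  -- just their linear span.
  have hcl : (Subsemigroup.closure (s ∪ star s) : Set _) ⊆ s := by
    intro x hx
    refine Subsemigroup.closure_induction (p := fun x _ => x ∈ s) ?_ ?_ hx
    · rintro x (hx | ⟨⟨a, b⟩, hx⟩)
      · exact hx
      · refine ⟨(star a, star b), ?_⟩
        rw [← star_star x, ← hx]
        simp [star_tensorOp, map_star]
    · rintro _ _ _ _ ⟨⟨a, b⟩, rfl⟩ ⟨⟨a', b'⟩, rfl⟩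
      exact ⟨(a * a', b * b'), by simp [tensorOp_mul]⟩
  have hle : (NonUnitalStarAlgebra.adjoin ℂ s).toSubmodule ≤ M := by
    rw [NonUnitalStarAlgebra.adjoin_eq_span]
    refine Submodule.span_le.2 fun x hx => ?_
    obtain ⟨⟨a, b⟩, rfl⟩ := hcl hx
    exact h a b
  have hT' : T ∈ closure (NonUnitalStarAlgebra.adjoin ℂ s : Set
      (HilbertTensor H K →L[ℂ] HilbertTensor H K)) := hT
  exact closure_minimal hle hM hT'

variable {π ρ} in
theorem clm_eq_of_mem_spatialTensor {G : Type*} [NormedAddCommGroup G] [NormedSpace ℂ G]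
    (L L' : (HilbertTensor H K →L[ℂ] HilbertTensor H K) →L[ℂ] G)
    (h : ∀ a b, L (tensorOp (π a) (ρ b)) = L' (tensorOp (π a) (ρ b)))
    {T : HilbertTensor H K →L[ℂ] HilbertTensor H K} (hT : T ∈ spatialTensor π ρ) : L T = L' T :=
  spatialTensor_induction (M := LinearMap.eqLocus L.toLinearMap L'.toLinearMap)
    (isClosed_eq L.continuous L'.continuous) h hT

end Spatial

end SpatialTensorProduct

/-! ### Simplicity of `A` and of its stabilization. -/

section Simplicity

/-- A closed ideal `I` of `A` generates the closed ideal `A ⊗ I` in `A ⊗ A`, and its left slices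
lie in `I`. -/
theorem exists_isClosed_ideal_spatialTensor {A H : Type*} [NonUnitalCStarAlgebra A]
    [NormedAddCommGroup H] [InnerProductSpace ℂ H] [CompleteSpace H]
    (π : A →⋆ₙₐ[ℂ] (H →L[ℂ] H)) (hπ : Function.Injective π)
    (I : Submodule ℂ A) (hI : IsClosed (I : Set A))
    (hl : ∀ a, ∀ i ∈ I, a * i ∈ I) (hr : ∀ a, ∀ i ∈ I, i * a ∈ I) :
    ∃ M : Submodule ℂ (HilbertTensor H H →L[ℂ] HilbertTensor H H),
      IsClosed (M : Set (HilbertTensor H H →L[ℂ] HilbertTensor H H)) ∧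
      (∀ a, ∀ i ∈ I, tensorOp (π a) (π i) ∈ M) ∧
      (∀ T ∈ spatialTensor π π, ∀ m ∈ M, T * m ∈ M) ∧
      (∀ T ∈ spatialTensor π π, ∀ m ∈ M, m * T ∈ M) ∧
      ∀ ξ ξ' : H, ∀ m ∈ M, ∃ i ∈ I, π i = leftSlice ξ ξ' m := by
  let N : Submodule ℂ (HilbertTensor H H →L[ℂ] HilbertTensor H H) :=
    Submodule.span ℂ {T | ∃ a, ∃ i ∈ I, T = tensorOp (π a) (π i)}
  obtain ⟨M, hMN⟩ : ∃ M, M = N.topologicalClosure := ⟨_, rfl⟩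
  have hMc : IsClosed (M : Set (HilbertTensor H H →L[ℂ] HilbertTensor H H)) :=
    hMN ▸ N.isClosed_topologicalClosure
  have hM : ∀ {M' : Submodule ℂ (HilbertTensor H H →L[ℂ] HilbertTensor H H)},
      IsClosed (M' : Set (HilbertTensor H H →L[ℂ] HilbertTensor H H)) →
      (∀ a, ∀ i ∈ I, tensorOp (π a) (π i) ∈ M') → M ≤ M' := by
    intro M' hc h
    rw [hMN]
    refine N.topologicalClosure_minimal (Submodule.span_le.2 ?_) hc
    rintro _ ⟨a, i, hi, rfl⟩
    exact h a i hi
  have hgen : ∀ a, ∀ i ∈ I, tensorOp (π a) (π i) ∈ M := fun a i hi =>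
    hMN ▸ N.le_topologicalClosure (Submodule.subset_span ⟨a, i, hi, rfl⟩)
  clear_value N
  refine ⟨M, hMc, hgen, fun T hT m hm => ?_, fun T hT m hm => ?_, fun ξ ξ' m hm => ?_⟩
  -- Membership of the product in `M` is a closed linear condition on each factor separately, so
  -- first `T` and then `m` may be taken elementary.
  · refine spatialTensor_induction (M := M.comap (LinearMap.mulRight ℂ m))
      (hMc.preimage (continuous_mul_const m)) (fun a b => ?_) hT
    refine hM (M' := M.comap (LinearMap.mulLeft ℂ (tensorOp (π a) (π b))))
      (hMc.preimage (continuous_const_mul _)) (fun a' i hi => ?_) hm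
    rw [Submodule.mem_comap, LinearMap.mulLeft_apply, tensorOp_mul, ← map_mul, ← map_mul]
    exact hgen _ _ (hl _ _ hi)
  · refine spatialTensor_induction (M := M.comap (LinearMap.mulLeft ℂ m))
      (hMc.preimage (continuous_const_mul m)) (fun a b => ?_) hT
    refine hM (M' := M.comap (LinearMap.mulRight ℂ (tensorOp (π a) (π b))))
      (hMc.preimage (continuous_mul_const _)) (fun a' i hi => ?_) hm
    rw [Submodule.mem_comap, LinearMap.mulRight_apply, tensorOp_mul, ← map_mul, ← map_mul]
    exact hgen _ _ (hr _ _ hi)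
  -- An injective representation is isometric, so `π` maps the closed `I` to a closed subspace.
  · have hc : IsClosed ((I.map (π : A →ₗ[ℂ] (H →L[ℂ] H)) : Submodule ℂ (H →L[ℂ] H)) :
        Set (H →L[ℂ] H)) := by
      rw [Submodule.map_coe]
      exact (NonUnitalStarAlgHom.isometry π hπ).isClosedEmbedding.isClosedMap _ hI
    refine hM (M' := (I.map (π : A →ₗ[ℂ] (H →L[ℂ] H))).comap (leftSlice ξ ξ').toLinearMap)
      (hc.preimage (leftSlice ξ ξ').continuous) (fun a i hi => ?_) hm
    refine ⟨inner ℂ ξ (π a ξ') • i, I.smul_mem _ hi, ?_⟩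
    simp [leftSlice_tensorOp]

/-- Strongly self-absorbing C*-algebras are simple. -/
theorem IsStronglySelfAbsorbing.one_mem {A : Type u} [CStarAlgebra A]
    (hA : IsStronglySelfAbsorbing A) (I : Submodule ℂ A) (hI : IsClosed (I : Set A))
    (hl : ∀ a, ∀ i ∈ I, a * i ∈ I) (hr : ∀ a, ∀ i ∈ I, i * a ∈ I) (h0 : I ≠ ⊥) : (1 : A) ∈ I := by
  obtain ⟨-, -, H, _, _, _, π, hπ, ψ, w, hw, hlim⟩ := hA
  by_contra h1
  obtain ⟨M, hMc, hgen, hleft, hright, hslice⟩ :=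
    exists_isClosed_ideal_spatialTensor π.toNonUnitalStarAlgHom hπ I hI hl hr
  -- `ψ j ∈ M` forces `j ⊗ 1 ∈ M` as a limit of unitary conjugates; a nonzero slice of it would be a
  -- nonzero scalar in `I`, contradicting `1 ∉ I`.
  have hψ : ∀ j : A, (ψ j : HilbertTensor H H →L[ℂ] HilbertTensor H H) ∈ M → j = 0 := by
    intro j hj
    have hj1 : tensorOp (π j) 1 ∈ M := by
      refine hMc.mem_of_tendsto (tendsto_iff_norm_sub_tendsto_zero.2 (hlim j))
        (Eventually.of_forall fun n => ?_)
      exact hright _ (star_mem (hw n).2) _ (hleft _ (hw n).2 _ hj)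
    have : π j = 0 := by
      refine ContinuousLinearMap.ext fun ξ' => ext_inner_left ℂ fun ξ => ?_
      obtain ⟨i, hi, hi'⟩ := hslice ξ ξ' _ hj1
      rw [leftSlice_tensorOp] at hi'
      by_contra hne
      simp only [zero_apply, inner_zero_right] at hne
      refine h1 ?_
      have : i = inner ℂ ξ (π j ξ') • 1 := hπ (by simpa using hi')
      rw [this] at hi
      simpa [hne] using I.smul_mem (inner ℂ ξ (π j ξ'))⁻¹ hi
    exact hπ (by simpa using this)
  refine h0 ((Submodule.eq_bot_iff _).2 fun i hi => ?_)
  obtain ⟨j, hj⟩ := ψ.surjective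
    ⟨_, tensorOp_mem_spatialTensor π.toNonUnitalStarAlgHom π.toNonUnitalStarAlgHom 1 i⟩
  change ψ j = _ at hj
  have hj0 : j = 0 := hψ j (by rw [hj]; exact hgen 1 i hi)
  rw [hj0, map_zero] at hj
  have h5 : tensorOp (π 1) (π i) = 0 := (congrArg Subtype.val hj).symm
  refine hπ ?_
  rw [map_zero]
  by_contra hne
  obtain ⟨ξ, hξ⟩ : ∃ ξ, π i ξ ≠ 0 := by
    by_contra! h
    exact hne (ContinuousLinearMap.ext h)
  have h6 := leftSlice_tensorOp ξ ξ (π 1) (π i)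
  rw [h5, map_zero, eq_comm, smul_eq_zero] at h6
  have : ξ = 0 := by simpa [hne] using h6
  simp [this] at hξ

/-- Compact operators are limits of operators of finite rank. -/
theorem IsCompactOperator.mem_closure_span_rankOne {H : Type*} [NormedAddCommGroup H]
    [InnerProductSpace ℂ H] [CompleteSpace H] {T : H →L[ℂ] H} (hT : IsCompactOperator T) :
    T ∈ closure (Submodule.span ℂ {S | ∃ x y : H, S = InnerProductSpace.rankOne ℂ x y} :
      Set (H →L[ℂ] H)) := by
  rw [Metric.mem_closure_iff]
  intro ε hε
  have htb : TotallyBounded (T '' Metric.closedBall 0 1) :=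
    (hT.isCompact_closure_image_closedBall (f := T.toLinearMap) 1).totallyBounded.subset
      subset_closure
  obtain ⟨t, htf, ht⟩ := Metric.totallyBounded_iff.1 htb (ε / 2) (half_pos hε)
  let V : Submodule ℂ H := Submodule.span ℂ t
  have : FiniteDimensional ℂ V := FiniteDimensional.span_of_finite ℂ htf
  -- Project onto the span of a finite `ε / 2`-net of the image of the unit ball.
  refine ⟨V.starProjection * T, ?_, ?_⟩
  · rw [(stdOrthonormalBasis ℂ V).starProjection_eq_sum_rankOne, Finset.sum_mul]
    refine Submodule.sum_mem _ fun i _ => Submodule.subset_span ?_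
    exact ⟨_, _, InnerProductSpace.rankOne_comp _ _ T⟩
  · rw [dist_eq_norm]
    refine lt_of_le_of_lt ?_ (half_lt_self hε)
    refine ContinuousLinearMap.opNorm_le_of_unit_norm (half_pos hε).le fun x hx => ?_
    obtain ⟨y, hy, hxy⟩ := Set.mem_iUnion₂.1 (ht ⟨x, by simp [hx], rfl⟩)
    have h1 : ‖T x - V.starProjection (T x)‖ ≤ ‖T x - y‖ := by
      rw [V.starProjection_minimal]
      exact ciInf_le ⟨0, by rintro _ ⟨z, rfl⟩; positivity⟩ (⟨y, Submodule.subset_span hy⟩ : V)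
    refine le_trans h1 ?_
    rw [← dist_eq_norm]
    exact (Metric.mem_ball.1 hxy).le

theorem rankOne_mem_compactOps (x y : EllTwo) : InnerProductSpace.rankOne ℂ x y ∈ compactOps :=
  (isCompactOperator_of_locallyCompactSpace_rng
    (ContinuousLinearMap.toSpanSingleton ℂ x)).comp_clm (innerSL ℂ y)

/-- The right slices of elements of a spatial tensor product lie in the left factor. -/
theorem rightSlice_mem_range {A B H K : Type*} [NonUnitalCStarAlgebra A] [NonUnitalCStarAlgebra B]
    [NormedAddCommGroup H] [InnerProductSpace ℂ H] [CompleteSpace H]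
    [NormedAddCommGroup K] [InnerProductSpace ℂ K] [CompleteSpace K]
    {π : A →⋆ₙₐ[ℂ] (H →L[ℂ] H)} {ρ : B →⋆ₙₐ[ℂ] (K →L[ℂ] K)} (hπ : Function.Injective π)
    (η η' : K) {T : HilbertTensor H K →L[ℂ] HilbertTensor H K} (hT : T ∈ spatialTensor π ρ) :
    ∃ a, π a = rightSlice η η' T := by
  have hc : IsClosed (((LinearMap.range (π : A →ₗ[ℂ] (H →L[ℂ] H))) : Submodule ℂ (H →L[ℂ] H)) :
      Set (H →L[ℂ] H)) := by
    rw [LinearMap.coe_range]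
    exact (NonUnitalStarAlgHom.isometry π hπ).isClosedEmbedding.isClosed_range
  exact spatialTensor_induction
    (M := (LinearMap.range (π : A →ₗ[ℂ] (H →L[ℂ] H))).comap (rightSlice η η').toLinearMap)
    (hc.preimage (rightSlice η η').continuous)
    (fun a k => ⟨inner ℂ η (ρ k η') • a, by simp [rightSlice_tensorOp]⟩) hT

/-- Compression of an operator by rank one operators on the second factor. -/
theorem tensorOp_rankOne_mul_mul {A B H K : Type*} [CStarAlgebra A] [NonUnitalCStarAlgebra B]
    [NormedAddCommGroup H] [InnerProductSpace ℂ H] [CompleteSpace H]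
    [NormedAddCommGroup K] [InnerProductSpace ℂ K] [CompleteSpace K]
    {π : A →⋆ₙₐ[ℂ] (H →L[ℂ] H)} {ρ : B →⋆ₙₐ[ℂ] (K →L[ℂ] K)}
    (u η η' : K) {T : HilbertTensor H K →L[ℂ] HilbertTensor H K} (hT : T ∈ spatialTensor π ρ) :
    tensorOp (π 1) (InnerProductSpace.rankOne ℂ u η) * T *
        tensorOp (π 1) (InnerProductSpace.rankOne ℂ η' u) =
      tensorOp (rightSlice η η' T) (InnerProductSpace.rankOne ℂ u u) := by
  -- Both sides are bounded and linear in `T`; for `T = π b ⊗ k` the identity is `|u⟩⟨η| k |η'⟩⟨u| =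
  -- ⟪η, k η'⟫ |u⟩⟨u|` in the second factor.
  refine clm_eq_of_mem_spatialTensor
    (((ContinuousLinearMap.mul ℂ _).flip
      (tensorOp (π 1) (InnerProductSpace.rankOne ℂ η' u))).comp
      (ContinuousLinearMap.mul ℂ _ (tensorOp (π 1) (InnerProductSpace.rankOne ℂ u η))))
    ((tensorOpL.flip (InnerProductSpace.rankOne ℂ u u)).comp (rightSlice η η'))
    (fun b k => ?_) hT
  simp only [ContinuousLinearMap.comp_apply, ContinuousLinearMap.flip_apply, tensorOpL_apply,
    ContinuousLinearMap.mul_apply', tensorOp_mul, rightSlice_tensorOp, ← map_mul, one_mul, mul_one]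
  refine HilbertTensor.clm_ext fun ξ ζ => ?_
  simp only [tensorOp_tmul]
  simp [← HilbertTensor.tmulL_apply, smul_smul]

/-- The stabilization of a strongly self-absorbing C*-algebra is simple. -/
theorem IsStronglySelfAbsorbing.spatialTensor_compactOps_le {A : Type u} [CStarAlgebra A]
    (hA : IsStronglySelfAbsorbing A) {H : Type*} [NormedAddCommGroup H] [InnerProductSpace ℂ H]
    [CompleteSpace H] (π : A →⋆ₙₐ[ℂ] (H →L[ℂ] H)) (hπ : Function.Injective π)
    (N : Submodule ℂ (HilbertTensor H EllTwo →L[ℂ] HilbertTensor H EllTwo))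
    (hN : IsClosed (N : Set (HilbertTensor H EllTwo →L[ℂ] HilbertTensor H EllTwo)))
    (hl : ∀ S ∈ spatialTensor π (NonUnitalStarSubalgebraClass.subtype compactOps), ∀ m ∈ N,
      S * m ∈ N)
    (hr : ∀ S ∈ spatialTensor π (NonUnitalStarSubalgebraClass.subtype compactOps), ∀ m ∈ N,
      m * S ∈ N)
    {T : HilbertTensor H EllTwo →L[ℂ] HilbertTensor H EllTwo}
    (hT : T ∈ spatialTensor π (NonUnitalStarSubalgebraClass.subtype compactOps)) (hTN : T ∈ N)
    (hT0 : T ≠ 0) {S : HilbertTensor H EllTwo →L[ℂ] HilbertTensor H EllTwo}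
    (hS : S ∈ spatialTensor π (NonUnitalStarSubalgebraClass.subtype compactOps)) : S ∈ N := by
  obtain ⟨u, hu⟩ : ∃ u : EllTwo, ‖u‖ = 1 := ⟨lp.single 2 0 1, by
    simp [lp.norm_single (p := 2) (E := fun _ : ℕ => ℂ) (by norm_num)]⟩
  have hel : ∀ (a : A) (x y : EllTwo), tensorOp (π a) (InnerProductSpace.rankOne ℂ x y) ∈
      spatialTensor π (NonUnitalStarSubalgebraClass.subtype compactOps) := fun a x y =>
    tensorOp_mem_spatialTensor π (NonUnitalStarSubalgebraClass.subtype compactOps) a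
      ⟨_, rankOne_mem_compactOps x y⟩
  have hmul : ∀ x z : EllTwo, InnerProductSpace.rankOne ℂ x u * InnerProductSpace.rankOne ℂ u z =
      (InnerProductSpace.rankOne ℂ x z : EllTwo →L[ℂ] EllTwo) := fun x z => by
    ext1 v
    simp [inner_self_eq_norm_sq_to_K, hu]
  -- The corner at `u` meets `N` nontrivially: compressing `T` into it produces every right slice of
  -- `T`, and these are not all zero.
  obtain ⟨a₀, ha₀, hne⟩ : ∃ a, tensorOp (π a) (InnerProductSpace.rankOne ℂ u u) ∈ N ∧ a ≠ 0 := by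
    by_contra! hcon
    refine hT0 (eq_zero_of_rightSlice_eq_zero fun η η' => ?_)
    obtain ⟨a, ha'⟩ := rightSlice_mem_range hπ η η' hT
    rw [← ha', hcon a ?_, map_zero]
    rw [ha', ← tensorOp_rankOne_mul_mul u η η' hT]
    exact hr _ (hel _ _ _) _ (hl _ (hel _ _ _) _ hTN)
  have h1 : tensorOp (π 1) (InnerProductSpace.rankOne ℂ u u) ∈ N := by
    obtain ⟨L, hL⟩ : ∃ L : (H →L[ℂ] H) →L[ℂ] (HilbertTensor H EllTwo →L[ℂ] HilbertTensor H EllTwo),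
        ∀ S, L S = tensorOp S (InnerProductSpace.rankOne ℂ u u) :=
      ⟨tensorOpL.flip (InnerProductSpace.rankOne ℂ u u), fun _ => rfl⟩
    -- The corner at `u` is a copy of `A`; its intersection with `N` is a nonzero closed ideal,
    -- hence contains the unit.
    let I : Submodule ℂ A := N.comap (L.toLinearMap.comp (π : A →ₗ[ℂ] (H →L[ℂ] H)))
    have hI : ∀ a, a ∈ I ↔ tensorOp (π a) (InnerProductSpace.rankOne ℂ u u) ∈ N := fun a => by
      rw [← hL]; rfl
    have hIc : IsClosed (I : Set A) :=
      hN.preimage (L.continuous.comp (NonUnitalStarAlgHom.isometry π hπ).continuous)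
    refine (hI 1).1 (hA.one_mem I hIc (fun a i hi => ?_) (fun a i hi => ?_) ?_)
    · rw [hI] at hi ⊢
      have := hl _ (hel a u u) _ hi
      rwa [tensorOp_mul, ← map_mul, hmul u u] at this
    · rw [hI] at hi ⊢
      have := hr _ (hel a u u) _ hi
      rwa [tensorOp_mul, ← map_mul, hmul u u] at this
    · exact (Submodule.ne_bot_iff _).2 ⟨a₀, (hI a₀).2 ha₀, hne⟩
  refine spatialTensor_induction hN (fun a k => ?_) hS
  have hk : (k : EllTwo →L[ℂ] EllTwo) ∈ N.comap (tensorOpL (π a)).toLinearMap := by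
    refine closure_minimal (Submodule.span_le.2 ?_) (hN.preimage (tensorOpL (π a)).continuous)
      (IsCompactOperator.mem_closure_span_rankOne k.2)
    rintro _ ⟨x, y, rfl⟩
    -- `a ⊗ |x⟩⟨y| = (a ⊗ |x⟩⟨u|) (1 ⊗ |u⟩⟨u|) (1 ⊗ |u⟩⟨y|)`.
    have := hr _ (hel 1 u y) _ (hl _ (hel a x u) _ h1)
    rwa [tensorOp_mul, tensorOp_mul, ← map_mul, ← map_mul, hmul x u, hmul x y, mul_one,
      mul_one] at this
  exact hk

/-- A `*`-homomorphism out of the stabilization of a strongly self-absorbing C*-algebra is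
injective or zero. -/
theorem IsStronglySelfAbsorbing.injective_or_eq_zero {A : Type u} [CStarAlgebra A]
    (hA : IsStronglySelfAbsorbing A) {F : Type*} [NonUnitalCStarAlgebra F]
    (hF : IsStabilization A F) {C : Type*} [NonUnitalCStarAlgebra C] (χ : F →⋆ₙₐ[ℂ] C) :
    Function.Injective χ ∨ χ = 0 := by
  obtain ⟨H, _, _, _, π, hπ, ⟨θ⟩⟩ := hF
  rw [or_iff_not_imp_left, injective_iff_map_eq_zero]
  intro h
  push Not at h
  obtain ⟨f, hf, hf0⟩ := h
  let B := spatialTensor π (NonUnitalStarSubalgebraClass.subtype compactOps)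
  let ω : F →⋆ₙₐ[ℂ] (HilbertTensor H EllTwo →L[ℂ] HilbertTensor H EllTwo) :=
    (NonUnitalStarSubalgebraClass.subtype B).comp (θ : F →⋆ₙₐ[ℂ] B)
  have hω : Function.Injective ω := Subtype.val_injective.comp θ.injective
  have hωr : ∀ {S}, S ∈ B → ∃ g, ω g = S := fun {S} hS =>
    ⟨θ.symm ⟨S, hS⟩, by simp [ω]⟩
  -- The kernel of `χ`, transported into the concrete operator algebra, is a closed ideal there
  -- containing `ω f ≠ 0`, so it is everything.
  let N := (LinearMap.ker (χ : F →ₗ[ℂ] C)).map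
    (ω : F →ₗ[ℂ] (HilbertTensor H EllTwo →L[ℂ] HilbertTensor H EllTwo))
  have hN : IsClosed (N : Set (HilbertTensor H EllTwo →L[ℂ] HilbertTensor H EllTwo)) := by
    rw [Submodule.map_coe]
    refine (NonUnitalStarAlgHom.isometry ω hω).isClosedEmbedding.isClosedMap _ ?_
    exact isClosed_eq (map_continuous χ) continuous_const
  refine NonUnitalStarAlgHom.ext fun g => ?_
  have hmem := hA.spatialTensor_compactOps_le π hπ N hN ?_ ?_
    (T := ω f) (θ f).2 ⟨f, hf, rfl⟩ (fun h => hf0 (hω (by simpa using h))) (θ g).2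
  · obtain ⟨g', hg', hgg⟩ := hmem
    have : g' = g := hω hgg
    rw [← this]
    exact hg'
  · rintro S hS _ ⟨m, hm, rfl⟩
    obtain ⟨s, rfl⟩ := hωr hS
    have hm' : χ m = 0 := hm
    exact ⟨s * m, by simp [hm'], by simp⟩
  · rintro S hS _ ⟨m, hm, rfl⟩
    obtain ⟨s, rfl⟩ := hωr hS
    have hm' : χ m = 0 := hm
    exact ⟨m * s, by simp [hm'], by simp⟩

/-- The stabilization of a strongly self-absorbing C*-algebra has a faithful nonzero
representation. -/
theorem IsStronglySelfAbsorbing.exists_faithful {A : Type u} [CStarAlgebra A]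
    (hA : IsStronglySelfAbsorbing A) {F : Type*} [NonUnitalCStarAlgebra F]
    (hF : IsStabilization A F) :
    ∃ (H : Type u) (_ : NormedAddCommGroup H) (_ : InnerProductSpace ℂ H) (_ : CompleteSpace H)
      (ω : F →⋆ₙₐ[ℂ] (H →L[ℂ] H)), Function.Injective ω ∧ ω ≠ 0 := by
  obtain ⟨H, _, _, _, π, hπ, ⟨θ⟩⟩ := hF
  let B := spatialTensor π (NonUnitalStarSubalgebraClass.subtype compactOps)
  let ω : F →⋆ₙₐ[ℂ] (HilbertTensor H EllTwo →L[ℂ] HilbertTensor H EllTwo) :=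
    (NonUnitalStarSubalgebraClass.subtype B).comp (θ : F →⋆ₙₐ[ℂ] B)
  refine ⟨HilbertTensor H EllTwo, _, _, inferInstance, ω, Subtype.val_injective.comp θ.injective,
    fun h => ?_⟩
  have := hA.1
  let u : EllTwo := lp.single 2 0 1
  have hu : ‖u‖ = 1 := by
    simp [u, lp.norm_single (p := 2) (E := fun _ : ℕ => ℂ) (by norm_num)]
  have hmem := tensorOp_mem_spatialTensor π (NonUnitalStarSubalgebraClass.subtype compactOps) 1
    ⟨_, rankOne_mem_compactOps u u⟩
  have h0 : tensorOp (π 1) (InnerProductSpace.rankOne ℂ u u) = 0 := by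
    have := DFunLike.congr_fun h (θ.symm ⟨_, hmem⟩)
    simpa [ω] using this
  have h1 := rightSlice_tensorOp u u (π 1) (InnerProductSpace.rankOne ℂ u u)
  rw [h0, map_zero] at h1
  have h2 : π 1 = 0 := by simpa [inner_self_eq_norm_sq_to_K, hu] using h1.symm
  exact one_ne_zero (hπ (h2.trans (map_zero π).symm))

end Simplicity

/-! ### GNS representations, extreme quasi-states and existence of primitive ideals. -/

section GNS

open scoped ComplexOrder InnerProductSpace

variable {D : Type u} [NonUnitalCStarAlgebra D]

/-- Kadison's inequality for positive functionals. -/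
theorem norm_le_sqrt_mul_norm_toPreGNS (φ : StrongDual ℂ D) [PartialOrder D] [StarOrderedRing D]
    (f : D →ₚ[ℂ] ℂ) (hf : ∀ d, f d = φ d) (d : D) :
    ‖φ d‖ ≤ √‖φ‖ * ‖f.toPreGNS d‖ := by
  have hl := CStarAlgebra.increasingApproximateUnit D
  have : (CStarAlgebra.approximateUnit D).NeBot := inferInstance
  -- With no unit at hand, Cauchy-Schwarz is applied to `φ (e * d)` for `e` in an approximate unit,
  -- where `φ (e * star e) ≤ ‖φ‖`.
  refine le_of_tendsto (f := fun e : D => ‖φ (e * d)‖) (x := CStarAlgebra.approximateUnit D)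
    ((φ.continuous.tendsto d).norm.comp (hl.tendsto_mul_right d)) ?_
  filter_upwards [hl.eventually_norm] with e he
  have h1 := norm_inner_le_norm (𝕜 := ℂ) (f.toPreGNS (star e)) (f.toPreGNS d)
  rw [f.preGNS_inner_def, f.ofPreGNS_toPreGNS, f.ofPreGNS_toPreGNS, star_star, hf] at h1
  refine h1.trans ?_
  gcongr
  rw [f.preGNS_norm_def, f.ofPreGNS_toPreGNS, hf]
  refine Real.sqrt_le_sqrt ((Complex.re_le_norm _).trans ?_)
  refine (φ.le_opNorm _).trans ?_
  refine mul_le_of_le_one_right (norm_nonneg _) ?_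
  refine (norm_mul_le _ _).trans ?_
  rw [star_star, norm_star]
  exact mul_le_one₀ he (norm_nonneg _) he

/-- The Gelfand-Naimark-Segal representation of a positive functional on a C*-algebra, which need
not be unital, has a cyclic vector implementing the functional. -/
theorem exists_cyclic_of_positive (φ : StrongDual ℂ D) (hφ : ∀ d, 0 ≤ φ (star d * d)) :
    ∃ (H : Type u) (_ : NormedAddCommGroup H) (_ : InnerProductSpace ℂ H) (_ : CompleteSpace H)
      (π : D →⋆ₙₐ[ℂ] (H →L[ℂ] H)) (ξ : H), (∀ d, φ d = ⟪ξ, π d ξ⟫_ℂ) ∧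
        DenseRange (fun d => π d ξ) ∧ ‖ξ‖ ^ 2 ≤ ‖φ‖ := by
  let _ : PartialOrder D := CStarAlgebra.spectralOrder D
  have _ : StarOrderedRing D := CStarAlgebra.spectralOrderedRing D
  let f : D →ₚ[ℂ] ℂ := PositiveLinearMap.mk₀ (φ : D →ₗ[ℂ] ℂ) fun x hx => by
    obtain ⟨b, rfl⟩ := CStarAlgebra.nonneg_iff_eq_star_mul_self.1 hx
    exact hφ b
  have hf : ∀ d, f d = φ d := fun d => rfl
  let g : f.PreGNS →L[ℂ] ℂ := LinearMap.mkContinuous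
    ((φ : D →ₗ[ℂ] ℂ).comp f.ofPreGNS.toLinearMap) (√‖φ‖)
    fun a => norm_le_sqrt_mul_norm_toPreGNS φ f hf (f.ofPreGNS a)
  have hg : ∀ d, g (f.toPreGNS d) = φ d := fun d => rfl
  -- The Riesz vector of `φ`, viewed as a functional on the GNS space, takes the place of the class
  -- of the unit.
  let ξ : f.GNS := (InnerProductSpace.toDual ℂ f.GNS).symm g.fromCompletion
  have hξ : ∀ d, ⟪ξ, (f.toPreGNS d : f.GNS)⟫_ℂ = φ d := fun d => by
    rw [InnerProductSpace.toDual_symm_apply, ContinuousLinearMap.fromCompletion_apply_coe, hg]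
  have hπ : ∀ a, f.gnsNonUnitalStarAlgHom a ξ = (f.toPreGNS a : f.GNS) := by
    intro a
    refine ext_inner_right ℂ fun x => ?_
    refine UniformSpace.Completion.induction_on (p := fun x =>
      ⟪f.gnsNonUnitalStarAlgHom a ξ, x⟫_ℂ = ⟪(f.toPreGNS a : f.GNS), x⟫_ℂ) x
      (isClosed_eq (by fun_prop) (by fun_prop)) fun b => ?_
    rw [← ContinuousLinearMap.adjoint_inner_right, ← ContinuousLinearMap.star_eq_adjoint,
      ← map_star, f.gnsNonUnitalStarAlgHom_apply_coe, UniformSpace.Completion.inner_coe,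
      f.preGNS_inner_def, f.ofPreGNS_toPreGNS, f.leftMulMapPreGNS_apply]
    exact hξ _
  refine ⟨f.GNS, inferInstance, inferInstance, inferInstance, f.gnsNonUnitalStarAlgHom, ξ,
    fun d => ?_, ?_, ?_⟩
  · rw [hπ, hξ]
  · simp_rw [hπ]
    exact (UniformSpace.Completion.denseRange_coe (α := f.PreGNS)).comp
      f.toPreGNS.surjective.denseRange (UniformSpace.Completion.continuous_coe _)
  · have h1 : ‖ξ‖ ≤ √‖φ‖ := by
      rw [LinearIsometryEquiv.norm_map]
      refine ContinuousLinearMap.opNorm_le_bound _ (Real.sqrt_nonneg _) fun x => ?_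
      refine UniformSpace.Completion.induction_on (p := fun x =>
        ‖g.fromCompletion x‖ ≤ √‖φ‖ * ‖x‖) x
        (isClosed_le (by fun_prop) (by fun_prop)) fun b => ?_
      rw [ContinuousLinearMap.fromCompletion_apply_coe, UniformSpace.Completion.norm_coe]
      exact norm_le_sqrt_mul_norm_toPreGNS φ f hf (f.ofPreGNS b)
    calc ‖ξ‖ ^ 2 ≤ √‖φ‖ ^ 2 := by gcongr
      _ = ‖φ‖ := Real.sq_sqrt (norm_nonneg _)

variable {H : Type*} [NormedAddCommGroup H] [InnerProductSpace ℂ H] [CompleteSpace H]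

/-- The functional `d ↦ ⟪ξ, π d ξ⟫`. -/
def vectorFunctional (π : D →⋆ₙₐ[ℂ] (H →L[ℂ] H)) (ξ : H) : StrongDual ℂ D :=
  LinearMap.mkContinuous
    { toFun := fun d => ⟪ξ, π d ξ⟫_ℂ
      map_add' := fun a b => by simp
      map_smul' := fun c a => by simp } (‖ξ‖ ^ 2) fun d => by
    refine (norm_inner_le_norm _ _).trans ?_
    calc ‖ξ‖ * ‖π d ξ‖ ≤ ‖ξ‖ * (‖d‖ * ‖ξ‖) := by
          gcongr
          refine ((π d).le_opNorm ξ).trans ?_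
          gcongr
          exact NonUnitalStarAlgHom.norm_apply_le π d
      _ = ‖ξ‖ ^ 2 * ‖d‖ := by ring

theorem vectorFunctional_apply (π : D →⋆ₙₐ[ℂ] (H →L[ℂ] H)) (ξ : H) (d : D) :
    vectorFunctional π ξ d = ⟪ξ, π d ξ⟫_ℂ := rfl

theorem norm_vectorFunctional_le (π : D →⋆ₙₐ[ℂ] (H →L[ℂ] H)) (ξ : H) :
    ‖vectorFunctional π ξ‖ ≤ ‖ξ‖ ^ 2 :=
  LinearMap.mkContinuous_norm_le _ (sq_nonneg _) _

theorem vectorFunctional_star_mul_self (π : D →⋆ₙₐ[ℂ] (H →L[ℂ] H)) (ξ : H) (d : D) :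
    vectorFunctional π ξ (star d * d) = (‖π d ξ‖ ^ 2 : ℝ) := by
  rw [vectorFunctional_apply, map_mul, map_star, mul_apply_eq_comp,
    ContinuousLinearMap.star_eq_adjoint, ContinuousLinearMap.adjoint_inner_right,
    inner_self_eq_norm_sq_to_K]
  simp

/-- The positive functionals of norm at most one that vanish on the kernel of `ρ`. -/
def quasiStates (ρ : D →⋆ₙₐ[ℂ] (H →L[ℂ] H)) : Set (WeakDual ℂ D) :=
  {φ | ‖WeakDual.toStrongDual φ‖ ≤ 1 ∧ (∀ d, 0 ≤ φ (star d * d)) ∧ ∀ d, ρ d = 0 → φ d = 0}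

/-- Banach-Alaoglu. The condition is norm at most one, not equal to one, since without a unit the
states need not be weak-* closed. -/
theorem isCompact_quasiStates (ρ : D →⋆ₙₐ[ℂ] (H →L[ℂ] H)) : IsCompact (quasiStates ρ) := by
  refine (WeakDual.isCompact_closedBall (𝕜 := ℂ) (E := D) 0 1).of_isClosed_subset ?_
    fun φ hφ => by simpa using hφ.1
  have h : quasiStates ρ = (WeakDual.toStrongDual ⁻¹' Metric.closedBall (0 : StrongDual ℂ D) 1) ∩
      ((⋂ d : D, {φ | 0 ≤ φ (star d * d)}) ∩ ⋂ d : D, ⋂ _ : ρ d = 0, {φ | φ d = 0}) := by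
    ext φ
    simp [quasiStates]
  rw [h]
  refine (WeakDual.isClosed_closedBall 0 1).inter
    ((isClosed_iInter fun d => ?_).inter (isClosed_iInter fun d => isClosed_iInter fun _ => ?_))
  · exact isClosed_le continuous_const (WeakDual.eval_continuous _)
  · exact isClosed_eq (WeakDual.eval_continuous _) continuous_const

/-- If `ρ` is not zero, then there is a nonzero extreme point among the positive functionals of
norm at most one that vanish on the kernel of `ρ`. -/
theorem exists_mem_extremePoints_quasiStates {ρ : D →⋆ₙₐ[ℂ] (H →L[ℂ] H)} (hρ : ρ ≠ 0) :
    ∃ φ ∈ (quasiStates ρ).extremePoints ℝ, φ ≠ 0 := by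
  obtain ⟨d₀, hd₀⟩ : ∃ d, ρ d ≠ 0 := by
    by_contra! h
    exact hρ (NonUnitalStarAlgHom.ext h)
  obtain ⟨η, hη⟩ : ∃ η, ρ d₀ η ≠ 0 := by
    by_contra! h
    exact hd₀ (ContinuousLinearMap.ext h)
  have hη0 : η ≠ 0 := by
    rintro rfl
    simp at hη
  obtain ⟨ζ, hζ1, hζ⟩ : ∃ ζ, ‖ζ‖ = 1 ∧ ρ d₀ ζ ≠ 0 :=
    ⟨((‖η‖⁻¹ : ℝ) : ℂ) • η, by simp [norm_smul, hη0], by simp [hη, hη0]⟩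
  let φ₀ : WeakDual ℂ D := StrongDual.toWeakDual (vectorFunctional ρ ζ)
  have hφ₀ : φ₀ ∈ quasiStates ρ := by
    refine ⟨(norm_vectorFunctional_le ρ ζ).trans (by simp [hζ1]), fun d => ?_, fun d hd => ?_⟩
    · change 0 ≤ vectorFunctional ρ ζ (star d * d)
      rw [vectorFunctional_star_mul_self]
      exact_mod_cast sq_nonneg ‖ρ d ζ‖
    · change vectorFunctional ρ ζ d = 0
      simp [vectorFunctional_apply, hd]
  have : LocallyConvexSpace ℝ (WeakDual ℂ D) :=
    Topology.IsInducing.locallyConvexSpace (F := D → ℂ)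
      (f := { toFun := fun φ d => φ d, map_add' := fun _ _ => rfl, map_smul' := fun _ _ => rfl })
      ⟨rfl⟩
  -- Zero may be an extreme point. To avoid it, Krein-Milman is applied to the face where evaluation
  -- at `star d₀ * d₀` is maximal; the maximum is positive because of `φ₀`.
  let l : WeakDual ℂ D →L[ℝ] ℝ :=
    { toFun := fun φ => (φ (star d₀ * d₀)).re
      map_add' := fun _ _ => rfl
      map_smul' := fun c φ => by
        change (c • φ (star d₀ * d₀)).re = _
        simp
      cont := Complex.continuous_re.comp (WeakDual.eval_continuous _) }
  have hcomp := isCompact_quasiStates ρ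
  have hexp : IsExposed ℝ (quasiStates ρ)
      {z ∈ quasiStates ρ | ∀ w ∈ quasiStates ρ, l w ≤ l z} := fun _ => ⟨l, rfl⟩
  obtain ⟨z, hz, hzmax⟩ := hcomp.exists_isMaxOn ⟨φ₀, hφ₀⟩ l.continuous.continuousOn
  obtain ⟨φ, hφ⟩ := (hexp.isCompact hcomp).extremePoints_nonempty ⟨z, hz, hzmax⟩
  refine ⟨φ, hexp.isExtreme.extremePoints_subset_extremePoints hφ, ?_⟩
  rintro rfl
  have h1 : l φ₀ ≤ l 0 := hφ.1.2 φ₀ hφ₀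
  have h2 : l φ₀ = ‖ρ d₀ ζ‖ ^ 2 := by
    change (vectorFunctional ρ ζ (star d₀ * d₀)).re = _
    rw [vectorFunctional_star_mul_self, Complex.ofReal_re]
  rw [h2, map_zero] at h1
  have : 0 < ‖ρ d₀ ζ‖ := norm_pos_iff.2 hζ
  nlinarith

/-- The kernel of a nonzero representation is contained in a primitive ideal. -/
theorem exists_isPrimitiveIdeal_ker_le {ρ : D →⋆ₙₐ[ℂ] (H →L[ℂ] H)} (hρ : ρ ≠ 0) :
    ∃ P : TwoSidedIdeal D, IsPrimitiveIdeal P ∧ ∀ d, ρ d = 0 → d ∈ P := by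
  obtain ⟨φ, hφ, hφ0⟩ := exists_mem_extremePoints_quasiStates hρ
  rw [mem_extremePoints] at hφ
  obtain ⟨⟨hnorm, hpos, hker⟩, hext⟩ := hφ
  obtain ⟨G, _, _, _, π, ξ, hξ, hd, hξn⟩ :=
    exists_cyclic_of_positive (WeakDual.toStrongDual φ) hpos
  replace hξ : ∀ d, φ d = ⟪ξ, π d ξ⟫_ℂ := hξ
  replace hξn := hξn.trans hnorm
  have hadj : ∀ d x y, ⟪x, π d y⟫_ℂ = ⟪π (star d) x, y⟫_ℂ := fun d x y => by
    rw [map_star, ContinuousLinearMap.star_eq_adjoint, ContinuousLinearMap.adjoint_inner_left]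
  have hker' : ∀ d, ρ d = 0 → π d = 0 := by
    intro d hρd
    refine ContinuousLinearMap.ext fun x => ?_
    refine hd.induction_on (p := fun x => π d x = (0 : G →L[ℂ] G) x) x
      (isClosed_eq (by fun_prop) (by fun_prop)) fun b => ?_
    refine ext_inner_left ℂ fun y => ?_
    refine hd.induction_on (p := fun y => ⟪y, π d (π b ξ)⟫_ℂ = ⟪y, (0 : G →L[ℂ] G) (π b ξ)⟫_ℂ) y
      (isClosed_eq (by fun_prop) (by fun_prop)) fun a => ?_
    -- The matrix coefficient of `π d` at `π a ξ` and `π b ξ` is `φ (star a * (d * b))`.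
    have h := hker (star a * (d * b)) (by simp [hρd])
    rw [hξ, map_mul, map_mul, mul_apply_eq_comp, mul_apply_eq_comp, hadj, star_star] at h
    simpa using h
  have hvec : ∀ (v : G) (c : ℝ), 0 < c → ‖v‖ ^ 2 ≤ c →
      c⁻¹ • StrongDual.toWeakDual (vectorFunctional π v) ∈ quasiStates ρ := by
    intro v c hc hv
    refine ⟨?_, fun d => ?_, fun d hρd => ?_⟩
    · change ‖c⁻¹ • vectorFunctional π v‖ ≤ 1
      rw [norm_smul, norm_inv, Real.norm_of_nonneg hc.le, inv_mul_le_iff₀ hc, mul_one]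
      exact (norm_vectorFunctional_le π v).trans hv
    · change 0 ≤ c⁻¹ • vectorFunctional π v (star d * d)
      rw [vectorFunctional_star_mul_self, Complex.real_smul]
      exact_mod_cast mul_nonneg (inv_nonneg.2 hc.le) (sq_nonneg _)
    · change c⁻¹ • vectorFunctional π v d = 0
      simp [vectorFunctional_apply, hker' d hρd]
  refine ⟨TwoSidedIdeal.ker π, ⟨G, _, _, _, π, ⟨?_, fun V hV hinv => ?_⟩, rfl⟩, fun d h => ?_⟩
  · rintro rfl
    refine hφ0 (ContinuousLinearMap.ext fun d => ?_)
    exact (hξ d).trans (inner_zero_right ξ)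
  · have : CompleteSpace V := hV.completeSpace_coe
    have hinv' : ∀ d, ∀ w ∈ Vᗮ, π d w ∈ Vᗮ := fun d w hw => by
      rw [Submodule.mem_orthogonal] at hw ⊢
      intro v hv
      rw [hadj]
      exact hw _ (hinv _ _ hv)
    have htop : ∀ W : Submodule ℂ G, IsClosed (W : Set G) → (∀ d, π d ξ ∈ W) → W = ⊤ := by
      intro W hW h
      rw [eq_top_iff]
      rintro x -
      exact hd.induction_on (p := fun x => x ∈ W) x hW h
    -- If `V` were a proper nonzero invariant subspace, the components of `ξ` in `V` and `Vᗮ` would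
    -- both be nonzero and would split `φ` as a convex combination.
    obtain ⟨η, hη⟩ : ∃ η, η = V.starProjection ξ := ⟨_, rfl⟩
    obtain ⟨ζ, hζ⟩ : ∃ ζ, ζ = ξ - η := ⟨_, rfl⟩
    have hηV : η ∈ V := hη ▸ V.starProjection_apply_mem ξ
    have hζV : ζ ∈ Vᗮ := by
      rw [hζ, hη]
      exact V.sub_starProjection_mem_orthogonal ξ
    have hsum : ξ = η + ζ := by rw [hζ]; abel
    by_cases hη0 : η = 0
    · left
      rw [← Submodule.orthogonal_eq_top_iff]
      refine htop _ V.isClosed_orthogonal fun d => hinv' d _ ?_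
      rwa [hsum, hη0, zero_add]
    by_cases hζ0 : ζ = 0
    · right
      refine htop _ hV fun d => hinv d _ ?_
      rwa [hsum, hζ0, add_zero]
    exfalso
    have hort : ∀ v ∈ V, ∀ w ∈ Vᗮ, ⟪v, w⟫_ℂ = 0 := fun v hv w hw =>
      (Submodule.mem_orthogonal _ _).1 hw v hv
    have hort' : ∀ v ∈ V, ∀ w ∈ Vᗮ, ⟪w, v⟫_ℂ = 0 := fun v hv w hw =>
      (Submodule.mem_orthogonal' _ _).1 hw v hv
    have hsq : ‖ξ‖ ^ 2 = ‖η‖ ^ 2 + ‖ζ‖ ^ 2 := by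
      rw [hsum, sq, sq, sq]
      exact norm_add_sq_eq_norm_sq_add_norm_sq_of_inner_eq_zero _ _ (hort _ hηV _ hζV)
    have hηp : 0 < ‖η‖ ^ 2 := by positivity
    have hζp : 0 < ‖ζ‖ ^ 2 := by positivity
    set n := ‖ξ‖ ^ 2
    have hn : 0 < n := by linarith
    have ha : 0 < ‖η‖ ^ 2 / n := by positivity
    have hb : 0 < ‖ζ‖ ^ 2 / n := by positivity
    -- The weights `‖η‖² / n` and `‖ζ‖² / n` sum to one; the rescaled functionals are still
    -- quasi-states because `n = ‖ξ‖² ≤ 1`.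
    have h1 : (‖η‖ ^ 2 / n)⁻¹ • StrongDual.toWeakDual (vectorFunctional π η) = φ := by
      refine (hext _ (hvec η _ ha ?_) _ (hvec ζ _ hb ?_)
        ⟨‖η‖ ^ 2 / n, ‖ζ‖ ^ 2 / n, ha, hb, ?_, ?_⟩).1
      · rw [le_div_iff₀ hn]; nlinarith
      · rw [le_div_iff₀ hn]; nlinarith
      · rw [← add_div, ← hsq, div_self hn.ne']
      · refine ContinuousLinearMap.ext fun d => ?_
        change (‖η‖ ^ 2 / n) • ((‖η‖ ^ 2 / n)⁻¹ • ⟪η, π d η⟫_ℂ) +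
          (‖ζ‖ ^ 2 / n) • ((‖ζ‖ ^ 2 / n)⁻¹ • ⟪ζ, π d ζ⟫_ℂ) = φ d
        rw [smul_inv_smul₀ ha.ne', smul_inv_smul₀ hb.ne', hξ, hsum, map_add, inner_add_left, inner_add_right, inner_add_right,
          hort _ hηV _ (hinv' d _ hζV), hort' _ (hinv d _ hηV) _ hζV]
        ring
    -- Extremality makes the functional of `η` proportional to `φ`; since `⟪η, π d ξ⟫ = ⟪η, π d η⟫`,
    -- cyclicity of `ξ` makes `η` proportional to `ξ`.
    have h2 : η = ((‖η‖ ^ 2 / n : ℝ) : ℂ) • ξ := by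
      rw [← sub_eq_zero]
      refine ext_inner_right ℂ fun x => ?_
      refine hd.induction_on
        (p := fun x => ⟪η - ((‖η‖ ^ 2 / n : ℝ) : ℂ) • ξ, x⟫_ℂ = ⟪(0 : G), x⟫_ℂ) x
        (isClosed_eq (by fun_prop) (by fun_prop)) fun d => ?_
      have h3 : ⟪η, π d η⟫_ℂ = (‖η‖ ^ 2 / n) • φ d := by
        rw [← h1]
        exact (smul_inv_smul₀ ha.ne' (⟪η, π d η⟫_ℂ)).symm
      have h4 : ⟪η, π d ξ⟫_ℂ = ⟪η, π d η⟫_ℂ := by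
        rw [hsum, map_add, inner_add_right, hort _ hηV _ (hinv' d _ hζV), add_zero]
      rw [inner_sub_left, inner_smul_left, Complex.conj_ofReal, inner_zero_left, h4, h3, hξ,
        Complex.real_smul, sub_self]
    have h5 : ζ = 0 := by
      have h6 : ((‖η‖ ^ 2 / n : ℝ) : ℂ) • ξ ∈ V := h2 ▸ hηV
      have hc : ((‖η‖ ^ 2 / n : ℝ) : ℂ) ≠ 0 := Complex.ofReal_ne_zero.2 ha.ne'
      have h7 : ξ ∈ V := (V.smul_mem_iff hc).1 h6
      rw [hζ, hη, V.starProjection_eq_self_iff.2 h7, sub_self]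
    exact hζ0 h5
  · rw [TwoSidedIdeal.mem_ker]
    exact hker' d h

end GNS

/-! ### Constructing sections: cutoffs and bumps. -/

section Sections

variable {X : Type*} [TopologicalSpace X] (F : Type*) [NonUnitalCStarAlgebra F]
  (E : X → Type*) [∀ x, NonUnitalCStarAlgebra (E x)] [TopologicalSpace (Bundle.TotalSpace F E)]
  [FiberBundle F E] [IsCStarBundle F E]

variable {F E} in
-- Trivializations are fiberwise `*`-isomorphisms, hence isometric, so the norm can be computed in
-- `F`.
theorem continuous_norm_section (s : sectionAlgebra F E) : Continuous fun x => ‖(s : lp E ∞) x‖ := by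
  rw [continuous_iff_continuousAt]
  intro x₀
  have h := (continuous_section_iff F E _).1 s.2.1 x₀
  refine h.norm.congr ?_
  filter_upwards [eventually_starAlgEquiv F E x₀] with x ⟨φ, hφ⟩
  rw [hφ, NonUnitalStarAlgHom.norm_map φ (EquivLike.injective φ)]

variable {F E} in
/-- The product of a section with a continuous scalar function of absolute value at most one. -/
theorem exists_section_smul (s : sectionAlgebra F E) {h : X → ℂ} (hc : Continuous h)
    (h1 : ∀ x, ‖h x‖ ≤ 1) :
    ∃ s' : sectionAlgebra F E, ∀ x, (s' : lp E ∞) x = h x • (s : lp E ∞) x := by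
  have hle : ∀ x, ‖h x • (s : lp E ∞) x‖ ≤ ‖(s : lp E ∞) x‖ := fun x => by
    rw [norm_smul]
    exact mul_le_of_le_one_left (norm_nonneg _) (h1 x)
  refine ⟨⟨⟨fun x => h x • (s : lp E ∞) x, memℓp_infty ⟨‖(s : lp E ∞)‖, ?_⟩⟩, ?_, ?_⟩, fun x => rfl⟩
  · rintro _ ⟨x, rfl⟩
    exact (hle x).trans (lp.norm_apply_le_norm (by simp) _ x)
  · refine (continuous_section_iff F E _).2 fun x₀ => ?_
    refine (ContinuousAt.smul hc.continuousAt
      ((continuous_section_iff F E _).1 s.2.1 x₀)).congr ?_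
    filter_upwards [eventually_starAlgEquiv F E x₀] with x ⟨φ, hφ⟩
    simp [hφ]
  · exact squeeze_zero (fun _ => norm_nonneg _) hle s.2.2

variable {F E} in
/-- Every section is close to one that vanishes where the given section is small. -/
theorem exists_section_cutoff (s : sectionAlgebra F E) {ε : ℝ} (hε : 0 < ε) :
    ∃ s' : sectionAlgebra F E, ‖s - s'‖ ≤ 2 * ε ∧
      ∀ x, ‖(s : lp E ∞) x‖ ≤ ε → (s' : lp E ∞) x = 0 := by
  -- `g` is `0` up to `ε`, `1` from `2 * ε` on and linear between, so `s` changes only where its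
  -- norm is below `2 * ε`.
  obtain ⟨g, hg⟩ : ∃ g : ℝ → ℝ, g = fun r => min 1 (max 0 (r / ε - 1)) := ⟨_, rfl⟩
  have hgc : Continuous g := by rw [hg]; fun_prop
  have hg0 : ∀ r, 0 ≤ g r := fun r => by rw [hg]; exact le_min zero_le_one (le_max_left _ _)
  have hg1 : ∀ r, g r ≤ 1 := fun r => by rw [hg]; exact min_le_left _ _
  have hgs : ∀ r, r ≤ ε → g r = 0 := fun r hr => by
    have : r / ε - 1 ≤ 0 := by rw [sub_nonpos, div_le_one hε]; exact hr
    simp [hg, max_eq_left this]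
  have hgl : ∀ r, 2 * ε ≤ r → g r = 1 := fun r hr => by
    have : 1 ≤ r / ε - 1 := by rw [le_sub_iff_add_le, le_div_iff₀ hε]; linarith
    simp [hg, max_eq_right (zero_le_one.trans this), this]
  obtain ⟨s', hs'⟩ := exists_section_smul s (h := fun x => (g ‖(s : lp E ∞) x‖ : ℂ))
    (Complex.continuous_ofReal.comp (hgc.comp (continuous_norm_section s)))
    (fun x => by simpa [abs_of_nonneg (hg0 _)] using hg1 _)
  refine ⟨s', ?_, fun x hx => by rw [hs', hgs _ hx]; simp⟩
  refine lp.norm_le_of_forall_le (f := (s : lp E ∞) - (s' : lp E ∞)) (by positivity) fun x => ?_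
  have h : ((s : lp E ∞) - (s' : lp E ∞) : lp E ∞) x =
      ((1 - g ‖(s : lp E ∞) x‖ : ℝ) : ℂ) • (s : lp E ∞) x := by
    rw [lp.coeFn_sub, Pi.sub_apply, hs']
    push_cast
    rw [sub_smul, one_smul]
  rw [h, norm_smul, Complex.norm_real, Real.norm_of_nonneg (sub_nonneg.2 (hg1 _))]
  rcases le_total (2 * ε) ‖(s : lp E ∞) x‖ with hx | hx
  · rw [hgl _ hx]
    simpa using hε.le
  · exact (mul_le_of_le_one_left (norm_nonneg _) (by linarith [hg0 ‖(s : lp E ∞) x‖])).trans hx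

/-- There are sections through every point of the bundle, with arbitrarily small support. -/
theorem exists_section_eq [T2Space X] [LocallyCompactSpace X] (t : X) (a : E t) {U : Set X}
    (hU : U ∈ 𝓝 t) :
    ∃ s : sectionAlgebra F E, (s : lp E ∞) t = a ∧ ∀ x ∉ U, (s : lp E ∞) x = 0 := by
  classical
  let e := trivializationAt F E t
  have htB : t ∈ e.baseSet := FiberBundle.mem_baseSet_trivializationAt F E t
  obtain ⟨V, hVU, hV, htV⟩ := mem_nhds_iff.1 hU
  obtain ⟨f, hf1, hfc, hfs, hfI⟩ := exists_continuousMap_one_of_isCompact_subset_isOpen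
    (isCompact_singleton (x := t)) (hV.inter e.open_baseSet)
    (Set.singleton_subset_iff.2 ⟨htV, htB⟩)
  choose φ hφ using IsCStarBundle.exists_starAlgEquiv (F := F) (E := E) e
    (FiberBundle.trivialization_mem_atlas F E t)
  let v : F := φ t htB a
  -- The section that is constant in the trivialization, cut off by a compactly supported bump
  -- function and extended by zero.
  let s : ∀ x, E x := fun x => if h : x ∈ e.baseSet then (f x : ℂ) • (φ x h).symm v else 0
  have hsB : ∀ x (h : x ∈ e.baseSet), s x = (f x : ℂ) • (φ x h).symm v := fun x h => dif_pos h
  have hs0 : ∀ x, x ∉ tsupport f → s x = 0 := fun x hx => by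
    by_cases h : x ∈ e.baseSet
    · rw [hsB x h, image_eq_zero_of_notMem_tsupport hx]
      simp
    · exact dif_neg h
  have hle : ∀ x, ‖s x‖ ≤ ‖v‖ := fun x => by
    by_cases h : x ∈ e.baseSet
    · rw [hsB x h, norm_smul, NonUnitalStarAlgHom.norm_map (φ x h).symm (EquivLike.injective _)]
      refine mul_le_of_le_one_left (norm_nonneg _) ?_
      rw [Complex.norm_real, Real.norm_of_nonneg (hfI x).1]
      exact (hfI x).2
    · rw [show s x = 0 from dif_neg h, norm_zero]
      exact norm_nonneg _
  have hcont : Continuous fun x => Bundle.TotalSpace.mk' F x (s x) := by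
    rw [continuous_iff_continuousAt]
    intro x₀
    by_cases hx : x₀ ∈ tsupport f
    · have hx₀ := (hfs hx).2
      refine e.continuousAt_of_comp_left continuousAt_id hx₀ ?_
      have hcc : Continuous fun x => ((x, (f x : ℂ) • v) : X × F) :=
        continuous_id.prodMk ((Complex.continuous_ofReal.comp f.continuous).smul continuous_const)
      refine hcc.continuousAt.congr ?_
      filter_upwards [e.open_baseSet.mem_nhds hx₀] with x hxB
      refine Prod.ext (e.coe_fst' (x := Bundle.TotalSpace.mk' F x (s x)) hxB).symm ?_
      change _ = (e (Bundle.TotalSpace.mk' F x (s x))).2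
      rw [hφ x hxB, hsB x hxB, map_smul]
      simp
    · have hz := ((zero_mem (sectionAlgebra F E) : (0 : lp E ∞) ∈ _).1).continuousAt (x := x₀)
      refine hz.congr ?_
      filter_upwards [(isClosed_tsupport f).isOpen_compl.mem_nhds hx] with x hx'
      rw [hs0 x hx']
      rfl
  refine ⟨⟨⟨s, memℓp_infty ⟨‖v‖, ?_⟩⟩, hcont, ?_⟩, ?_, fun x hx => ?_⟩
  · rintro _ ⟨x, rfl⟩
    exact hle x
  · refine tendsto_const_nhds.congr' ?_
    filter_upwards [hfc.compl_mem_cocompact] with x hx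
    rw [hs0 x hx, norm_zero]
  · change s t = a
    have : f t = 1 := hf1 rfl
    rw [hsB t htB, this]
    simp [v]
  · exact hs0 x fun h => hx (hVU (hfs h).1)

/-- Evaluation of sections at a point. -/
def evalSection (t : X) : sectionAlgebra F E →⋆ₙₐ[ℂ] E t where
  toFun s := (s : lp E ∞) t
  map_smul' _ _ := rfl
  map_zero' := rfl
  map_add' _ _ := rfl
  map_mul' _ _ := rfl
  map_star' _ := rfl

theorem evalSection_apply (t : X) (s : sectionAlgebra F E) :
    evalSection F E t s = (s : lp E ∞) t := rfl

end Sections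

/-! ### Primitive ideals of the section algebra and the homeomorphism. -/

section PrimitiveIdeals

theorem IsPrimitiveIdeal.isClosed {D : Type u} [NonUnitalCStarAlgebra D] {P : TwoSidedIdeal D}
    (hP : IsPrimitiveIdeal P) : IsClosed {d | d ∈ P} := by
  obtain ⟨H, _, _, _, π, -, rfl⟩ := hP
  simp_rw [TwoSidedIdeal.mem_ker]
  exact isClosed_eq (map_continuous π) continuous_const

theorem IsPrimitiveIdeal.exists_notMem {D : Type u} [NonUnitalCStarAlgebra D] {P : TwoSidedIdeal D}
    (hP : IsPrimitiveIdeal P) : ∃ d, d ∉ P := by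
  obtain ⟨H, _, _, _, π, ⟨h0, -⟩, rfl⟩ := hP
  by_contra! h
  exact h0 (NonUnitalStarAlgHom.ext fun d => (TwoSidedIdeal.mem_ker π).1 (h d))

variable {X : Type*} [TopologicalSpace X] {F : Type*} [NonUnitalCStarAlgebra F]
  {E : X → Type*} [∀ x, NonUnitalCStarAlgebra (E x)] [TopologicalSpace (Bundle.TotalSpace F E)]
  [FiberBundle F E] [IsCStarBundle F E]

variable (F E) in
/-- The ideal of the sections that vanish on a set. -/
def vanishingIdealOn (C : Set X) : TwoSidedIdeal (sectionAlgebra F E) :=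
  ⨅ t : C, vanishingIdeal F E t

theorem mem_vanishingIdealOn {C : Set X} {s : sectionAlgebra F E} :
    s ∈ vanishingIdealOn F E C ↔ ∀ t ∈ C, (s : lp E ∞) t = 0 := by
  simp [vanishingIdealOn, TwoSidedIdeal.mem_iInf, mem_vanishingIdeal]

/-- Every primitive ideal of the section algebra contains some `I_t`. -/
theorem IsPrimitiveIdeal.exists_vanishingIdeal_le {P : TwoSidedIdeal (sectionAlgebra F E)}
    (hP : IsPrimitiveIdeal P) : ∃ t, vanishingIdeal F E t ≤ P := by
  -- As `P` is closed, a small enough cutoff of `s` is still outside `P`, and it vanishes where `s`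
  -- is small.
  have hcut : ∀ s ∉ P, ∃ ε > 0, ¬ vanishingIdealOn F E {x | ‖(s : lp E ∞) x‖ < ε} ≤ P := by
    intro s hs
    obtain ⟨δ, hδ, hball⟩ := Metric.isOpen_iff.1 hP.isClosed.isOpen_compl s hs
    obtain ⟨s', hs', hs0⟩ := exists_section_cutoff s (show 0 < δ / 3 by positivity)
    refine ⟨δ / 3, by positivity, fun hle => ?_⟩
    refine hball (a := s') ?_ (hle (mem_vanishingIdealOn.2 fun x hx => hs0 x (le_of_lt hx)))
    rw [Metric.mem_ball, dist_comm, dist_eq_norm]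
    linarith
  by_contra! hcon
  obtain ⟨s, hs⟩ := hP.exists_notMem
  obtain ⟨ε, hε, hsε⟩ := hcut s hs
  obtain ⟨K, hK, hKs⟩ := mem_cocompact.1 (s.2.2.eventually_lt_const hε)
  have hmono : ∀ {S T : Set X}, S ⊆ T → ¬ vanishingIdealOn F E T ≤ P →
      ¬ vanishingIdealOn F E S ≤ P := fun hST hT hS =>
    hT (le_trans (fun r hr => mem_vanishingIdealOn.2 fun t ht =>
      mem_vanishingIdealOn.1 hr t (hST ht)) hS)
  have hunion : ∀ {S T : Set X}, ¬ vanishingIdealOn F E S ≤ P → ¬ vanishingIdealOn F E T ≤ P →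
      ¬ vanishingIdealOn F E (S ∪ T) ≤ P := by
    intro S T hS hT h
    refine (hP.le_or_le (le_trans (fun r hr => ?_) h)).elim hS hT
    rw [mem_vanishingIdealOn]
    rintro t (ht | ht)
    · exact mem_vanishingIdealOn.1 hr.1 t ht
    · exact mem_vanishingIdealOn.1 hr.2 t ht
  -- Call `S` negligible if some section vanishing on `S` lies outside `P`. Subsets and, by
  -- primeness, finite unions of negligible sets are negligible. If no `I_t` lies in `P`, each point
  -- has a negligible neighborhood, so `K` is negligible; so is its complement, where `s` is small.
  -- Their union `X` is not.
  have hKP : ¬ vanishingIdealOn F E K ≤ P := by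
    refine hK.induction_on (p := fun S => ¬ vanishingIdealOn F E S ≤ P) ?_
      (fun _ _ h => hmono h) (fun _ _ => hunion) fun t _ => ?_
    · exact fun h => hs (h (mem_vanishingIdealOn.2 fun t ht => ht.elim))
    · obtain ⟨r, hr, hrP⟩ := SetLike.not_le_iff_exists.1 (hcon t)
      obtain ⟨ε', hε', hr'⟩ := hcut r hrP
      refine ⟨_, mem_nhdsWithin_of_mem_nhds ?_, hr'⟩
      refine (isOpen_lt (continuous_norm_section r) continuous_const).mem_nhds ?_
      rw [Set.mem_ofPred_eq, (mem_vanishingIdeal F E).1 hr, norm_zero]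
      exact hε'
  refine hunion hKP (hmono hKs hsε) fun r hr => ?_
  have : r = 0 := by
    ext t
    exact mem_vanishingIdealOn.1 hr t (Set.union_compl_self K ▸ Set.mem_univ t)
  rw [this]
  exact P.zero_mem

variable [T2Space X] [LocallyCompactSpace X] {A : Type v} [CStarAlgebra A]

/-- A representation with kernel `P` factors through evaluation at `t`, and the induced
representation of the simple fiber is nonzero, hence injective. -/
theorem IsPrimitiveIdeal.eq_vanishingIdeal (hA : IsStronglySelfAbsorbing A)
    (hF : IsStabilization A F) {P : TwoSidedIdeal (sectionAlgebra F E)} (hP : IsPrimitiveIdeal P)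
    {t : X} (ht : vanishingIdeal F E t ≤ P) : P = vanishingIdeal F E t := by
  refine le_antisymm ?_ ht
  obtain ⟨H, _, _, _, π, ⟨h0, -⟩, rfl⟩ := hP
  -- The lifts are arbitrary; `hπ` shows that `π` does not depend on them, which makes `σ` a
  -- homomorphism.
  choose lift hlift using fun a : E t => exists_section_eq F E t a univ_mem
  have hπ : ∀ s s' : sectionAlgebra F E, (s : lp E ∞) t = (s' : lp E ∞) t → π s = π s' := by
    intro s s' h
    rw [← sub_eq_zero, ← map_sub, ← TwoSidedIdeal.mem_ker π]
    refine ht ((mem_vanishingIdeal F E).2 ?_)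
    rw [← evalSection_apply, map_sub, sub_eq_zero]
    exact h
  let σ : E t →⋆ₙₐ[ℂ] (H →L[ℂ] H) :=
    { toFun := fun a => π (lift a)
      map_smul' := fun c a => by
        rw [MonoidHom.id_apply, ← map_smul]
        refine hπ _ _ ((hlift _).1.trans ?_)
        exact congrArg (c • ·) (hlift a).1.symm
      map_zero' := (hπ _ 0 (hlift 0).1).trans (map_zero π)
      map_add' := fun a b => by
        rw [← map_add]
        refine hπ _ _ ((hlift _).1.trans ?_)
        exact congrArg₂ (· + ·) (hlift a).1.symm (hlift b).1.symm
      map_mul' := fun a b => by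
        rw [← map_mul]
        refine hπ _ _ ((hlift _).1.trans ?_)
        exact congrArg₂ (· * ·) (hlift a).1.symm (hlift b).1.symm
      map_star' := fun a => by
        rw [← map_star]
        refine hπ _ _ ((hlift _).1.trans ?_)
        exact congrArg star (hlift a).1.symm }
  have hσ : ∀ s : sectionAlgebra F E, π s = σ ((s : lp E ∞) t) := fun s =>
    hπ _ _ (hlift _).1.symm
  obtain ⟨φ, -⟩ := (eventually_starAlgEquiv F E t).self_of_nhds
  rcases hA.injective_or_eq_zero hF (σ.comp (φ.symm : F →⋆ₙₐ[ℂ] E t)) with hinj | hzero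
  · intro s hs
    rw [TwoSidedIdeal.mem_ker, hσ] at hs
    rw [mem_vanishingIdeal F E]
    have : φ ((s : lp E ∞) t) = 0 := hinj (by
      rw [map_zero, NonUnitalStarAlgHom.comp_apply]
      simpa using hs)
    simpa using this
  · refine absurd (NonUnitalStarAlgHom.ext fun s => ?_) h0
    have := DFunLike.congr_fun hzero (φ ((s : lp E ∞) t))
    rw [NonUnitalStarAlgHom.comp_apply] at this
    rw [hσ]
    simpa using this

/-- The ideals `I_t` are primitive. -/
theorem isPrimitiveIdeal_vanishingIdeal (hA : IsStronglySelfAbsorbing A)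
    (hF : IsStabilization A F) (t : X) : IsPrimitiveIdeal (vanishingIdeal F E t) := by
  obtain ⟨H, _, _, _, ω, hω, hω0⟩ := hA.exists_faithful hF
  obtain ⟨φ, -⟩ := (eventually_starAlgEquiv F E t).self_of_nhds
  let ρ : sectionAlgebra F E →⋆ₙₐ[ℂ] (H →L[ℂ] H) :=
    (ω.comp (φ : E t →⋆ₙₐ[ℂ] F)).comp (evalSection F E t)
  have hρ : ρ ≠ 0 := by
    intro h
    refine hω0 (NonUnitalStarAlgHom.ext fun f => ?_)
    obtain ⟨s, hs, -⟩ := exists_section_eq F E t (φ.symm f) univ_mem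
    have := DFunLike.congr_fun h s
    simpa [ρ, evalSection_apply, hs] using this
  -- `ρ` need not be irreducible. The passage through GNS supplies an irreducible representation, on
  -- a Hilbert space in the universe of the section algebra.
  obtain ⟨P, hP, hle⟩ := exists_isPrimitiveIdeal_ker_le hρ
  have hPt : vanishingIdeal F E t ≤ P := fun s hs => hle s (by
    simp [ρ, evalSection_apply, (mem_vanishingIdeal F E).1 hs])
  exact hP.eq_vanishingIdeal hA hF hPt ▸ hP

theorem isClosed_prim_iff {D : Type u} [NonUnitalCStarAlgebra D] {C : Set (Prim D)} :
    IsClosed C ↔ ∃ J, hull J = C := by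
  rw [← isOpen_compl_iff]
  change Cᶜᶜ ∈ Set.range hull ↔ _
  rw [compl_compl]
  rfl

/-- A point off `C` is separated from `C` by a bump section; its value at the point can be taken
nonzero since `I_t` is proper. -/
theorem vanishingIdealOn_le_iff (hA : IsStronglySelfAbsorbing A) (hF : IsStabilization A F)
    {C : Set X} (hC : IsClosed C) {t : X} :
    vanishingIdealOn F E C ≤ vanishingIdeal F E t ↔ t ∈ C := by
  refine ⟨fun h => ?_, fun h s hs => (mem_vanishingIdeal F E).2 (mem_vanishingIdealOn.1 hs t h)⟩
  by_contra ht
  obtain ⟨s₀, hs₀⟩ := (isPrimitiveIdeal_vanishingIdeal (E := E) hA hF t).exists_notMem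
  obtain ⟨s, hs, hsC⟩ := exists_section_eq F E t ((s₀ : lp E ∞) t) (hC.isOpen_compl.mem_nhds ht)
  refine hs₀ ((mem_vanishingIdeal F E).2 (hs.symm.trans ((mem_vanishingIdeal F E).1 (h ?_))))
  exact mem_vanishingIdealOn.2 fun x hx => hsC x (fun hx' => hx' hx)

/-- The map `t ↦ I_t` is a homeomorphism onto the primitive ideal space. -/
theorem exists_homeomorph_prim (hA : IsStronglySelfAbsorbing A) (hF : IsStabilization A F) :
    ∃ Φ : X ≃ₜ Prim (sectionAlgebra F E), ∀ t : X, (Φ t).1 = vanishingIdeal F E t := by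
  let f : X → Prim (sectionAlgebra F E) := fun t =>
    ⟨vanishingIdeal F E t, isPrimitiveIdeal_vanishingIdeal hA hF t⟩
  have hinj : Function.Injective f := by
    intro t t' h
    have h' : vanishingIdeal F E t = vanishingIdeal F E t' := congrArg Subtype.val h
    have h1 : vanishingIdealOn F E {t'} ≤ vanishingIdeal F E t := by
      rw [h', vanishingIdealOn_le_iff hA hF isClosed_singleton]
      rfl
    exact (vanishingIdealOn_le_iff hA hF isClosed_singleton).1 h1
  have hsurj : Function.Surjective f := by
    rintro ⟨P, hP⟩
    obtain ⟨t, ht⟩ := hP.exists_vanishingIdeal_le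
    exact ⟨t, Subtype.ext (hP.eq_vanishingIdeal hA hF ht).symm⟩
  have hcont : Continuous f := by
    rw [continuous_iff_isClosed]
    intro C hC
    obtain ⟨J, rfl⟩ := isClosed_prim_iff.1 hC
    -- The hull of `J` pulls back to the common zero set of the sections in `J`.
    have : f ⁻¹' hull J = ⋂ s ∈ J, {t | ‖((s : sectionAlgebra F E) : lp E ∞) t‖ = 0} := by
      ext t
      simp only [Set.mem_preimage, Set.mem_iInter, Set.mem_ofPred_eq, norm_eq_zero]
      exact ⟨fun h s hs => (mem_vanishingIdeal F E).1 (h hs), fun h s hs => (mem_vanishingIdeal F E).2 (h s hs)⟩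
    rw [this]
    exact isClosed_iInter fun s => isClosed_iInter fun _ =>
      isClosed_eq (continuous_norm_section s) continuous_const
  have hclosed : IsClosedMap f := by
    intro C hC
    -- The image of `C` is the hull of the sections vanishing on `C`.
    refine isClosed_prim_iff.2 ⟨vanishingIdealOn F E C, ?_⟩
    ext P
    obtain ⟨t, rfl⟩ := hsurj P
    rw [hinj.mem_set_image]
    exact vanishingIdealOn_le_iff hA hF hC
  exact ⟨(Equiv.ofBijective f ⟨hinj, hsurj⟩).toHomeomorphOfContinuousClosed hcont hclosed,
    fun t => rfl⟩

end PrimitiveIdeals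

end

theorem mainTheorem1
    {A : Type*} [CStarAlgebra A] (hA : IsStronglySelfAbsorbing A)
    {F : Type*} [NonUnitalCStarAlgebra F] (hF : IsStabilization A F)
    {n : ℕ} {X : Type*} [TopologicalSpace X] [T2Space X]
    [ChartedSpace (EuclideanSpace ℝ (Fin n)) X] [MulAction Circle X]
    {W : Type*} [TopologicalSpace W] (p : X → W) (hp : IsPrincipalCircleBundle p)
    (E : X → Type*) [∀ x, NonUnitalCStarAlgebra (E x)]
    [TopologicalSpace (Bundle.TotalSpace F E)] [FiberBundle F E] [IsCStarBundle F E] :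
    ∃ Φ : X ≃ₜ Prim (sectionAlgebra F E), ∀ t : X, (Φ t).1 = vanishingIdeal F E t := by
  have : LocallyCompactSpace X := ChartedSpace.locallyCompactSpace (EuclideanSpace ℝ (Fin n)) X
  exact exists_homeomorph_prim hA hF
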